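/- Consider a finite-horizon MDP with horizon $H\ge 1$, state space $\mathcal S$ and action space $\mathcal A$ (standard Borel), initial law of $s_1$, joint law $P(r,s'\mid s,a)$ of reward $r\in[0,1]$ and next state, the timestep $t(s)$ being readable from the state. For a policy $\pi(a\mid s)$ let $P_\pi$ be the law of the trajectory $(s_1,a_1,r_1,\dots,s_H,a_H,r_H)$, let $J(\pi)=\mathbb E_{P_\pi}[\sum_{t=1}^H r_t]$, let $g=\sum_{t'\ge t(s)} r_{t'}$ denote the return obtained from state $s$ on, and let $P_\pi(s)$ and $P_\pi(s,g,a)$ be the marginals of state, and of (state, return from it, action), with the timestep uniform in $\{1,\dots,H\}$. Let $\beta$ be a behavior policy, let $f:\mathcal S\to\mathbb R$ be a measurable conditioning function, and let $$\pi_f^{\mathrm{RCSL}}(a\mid s)=\beta(a\mid s)\,\frac{P_\beta(g=f(s)\mid s,a)}{P_\beta(g=f(s)\mid s)} .$$ Assume: 1. Near determinism: there are measurable functions $T,\rho$ with $P(r\ne \rho(s,a)\text{ or }s'\ne T(s,a)\mid s,a)\le\epsilon$ for all $s,a$. 2. Consistency of $f$: $f(s)=f(s')+r$ almost surely at every transition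 $(s,a)\to(r,s')$ with $t(s)<H$. 3. Choice of $f$: there is a deterministic optimal policy $\pi^*$ such that, for (almost) all initial states $s_1$, $f(s_1)$ is the return of $\pi^*$ from $s_1$ under the deterministic dynamics, i.e. $f(s_1)=\sum_{t=1}^H\rho(\bar s_t,\pi^*(\bar s_t))$ with $\bar s_1=s_1$, $\bar s_{t+1}=T(\bar s_t,\pi^*(\bar s_t))$. 4. Return coverage: $P_\beta(g=f(s)\mid s)\ge\alpha_f>0$ for $P_\beta$-almost all $s$ (in particular for almost all initial states). 5. Bounded occupancy mismatch: $P_{\pi_f^{\mathrm{RCSL}}}(s)\le C_f\,P_\beta(s)$ (as measures on $\mathcal S$). 6. $\Pi$ is a finite class of return-conditioned policies $\pi(a\mid s,g)$, given by everywhere positive densities with respect to a $\sigma$-finite measure on $\mathcal A$ (counting measure if actions are discrete), and $|\log\pi(a\mid s,g)-\log\pi(a'\mid s',g')|\le c$ for all $(a,s,g,a',s',g')$ and all $\pi\in\Pi$. 7. $\min_{\pi\in\Pi}L(\pi)\le\epsilon_{approx}$, where $L(\pi)=\mathbb E_{s\sim P_\beta}\mathbb E_{g\sim P_\beta(\cdot\mid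 s)}\big[D_{\mathrm{KL}}(P_\beta(\cdot\mid s,g)\,\|\,\pi(\cdot\mid s,g))\big]$. Let $\mathcal D$ consist of $N\ge1$ independent trajectories drawn from $P_\beta$, and let $\delta\in(0,1)$. Then, with probability at least $1-\delta$, every minimizer $\hat\pi$ over $\Pi$ of the empirical loss $-\sum_{\tau\in\mathcal D}\sum_{t=1}^H\log\pi(a_t\mid s_t,g_t)$, $g_t=\sum_{t'\ge t}r_{t'}$, satisfies, for $\hat\pi_f(a\mid s)=\hat\pi(a\mid s,f(s))$, $$J(\pi^*)-J(\hat\pi_f)\le K\left(\frac{C_f}{\alpha_f}H^2\left(\sqrt c\left(\frac{\log(|\Pi|/\delta)}{N}\right)^{1/4}+\sqrt{\epsilon_{approx}}\right)+\frac{\epsilon}{\alpha_f}H^2\right),$$ where $K$ is a universal constant. -/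

import Mathlib

open MeasureTheory ProbabilityTheory
open scoped ENNReal

universe u v

noncomputable section

/-- A finite-horizon Markov decision process with state space `S` and action space `A`.
`step (s, a)` is the joint law of the reward and the next state. The (one-based) timestep can be
read off the state; transitions out of a state of timestep `horizon` only matter through
their reward. -/
structure MDP (S : Type u) (A : Type v) [MeasurableSpace S] [MeasurableSpace A] where
  horizon : ℕ
  horizon_pos : 0 < horizon
  init : Measure S
  init_prob : IsProbabilityMeasure init
  step : Kernel (S × A) (ℝ × S)
  step_markov : IsMarkovKernel step
  time : S → ℕ
  time_measurable : Measurable time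
  init_time : ∀ᵐ s ∂init, time s = 1
  step_time : ∀ s a, time s < horizon → ∀ᵐ p ∂(step (s, a)), time p.2 = time s + 1
  reward_mem : ∀ s a, ∀ᵐ p ∂(step (s, a)), p.1 ∈ Set.Icc (0 : ℝ) 1

/-- Trajectories of `k` steps: the `t`-th entry is `(s_t, a_t, r_t)`. -/
abbrev Traj (S : Type u) (A : Type v) (k : ℕ) : Type (max u v) := Fin k → S × A × ℝ

/-- Sum of the rewards from index `t` on (return-to-go at step `t`). -/
def returnToGo {S : Type u} {A : Type v} {k : ℕ} (τ : Traj S A k) (t : Fin k) : ℝ :=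
  ∑ j ∈ Finset.Ici t, (τ j).2.2

/-- Sum of all the rewards of a trajectory. -/
def totalReturn {S : Type u} {A : Type v} {k : ℕ} (τ : Traj S A k) : ℝ :=
  ∑ j, (τ j).2.2

/-- A return-conditioned policy `π(a | s, g)`, given by a density with respect to a reference
measure `ν` on the actions (counting measure when actions are discrete). -/
structure CondPolicy (S : Type u) (A : Type v) [MeasurableSpace S] [MeasurableSpace A]
    (ν : Measure A) where
  dens : S → ℝ → A → ℝ
  dens_measurable : Measurable fun p : (S × ℝ) × A => dens p.1.1 p.1.2 p.2
  dens_nonneg : ∀ s g a, 0 ≤ dens s g a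
  dens_lintegral : ∀ s g, ∫⁻ a, ENNReal.ofReal (dens s g a) ∂ν = 1

namespace CondPolicy

variable {S : Type u} {A : Type v} [MeasurableSpace S] [MeasurableSpace A] {ν : Measure A}

/-- The conditional law `π(· | s, g)`, as a kernel in `(s, g)`. -/
def toKernel [SFinite ν] (π : CondPolicy S A ν) : Kernel (S × ℝ) A :=
  Kernel.withDensity (Kernel.const (S × ℝ) ν) fun p a => ENNReal.ofReal (π.dens p.1 p.2 a)

/-- The test-time policy `π_f(a | s) = π(a | s, f(s))`. -/
def test [SFinite ν] (π : CondPolicy S A ν) (f : S → ℝ) (hf : Measurable f) : Kernel S A :=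
  π.toKernel.comap (fun s => (s, f s)) (measurable_id.prodMk hf)

/-- `|log π(a|s,g) - log π(a'|s',g')| ≤ c` for all arguments (all logarithms being finite). -/
def LogBounded (π : CondPolicy S A ν) (c : ℝ) : Prop :=
  (∀ s g a, 0 < π.dens s g a) ∧
    ∀ s g a s' g' a', |Real.log (π.dens s g a) - Real.log (π.dens s' g' a')| ≤ c

/-- The empirical negative log-likelihood of a dataset of trajectories. -/
def empiricalLoss (π : CondPolicy S A ν) {N k : ℕ} (D : Fin N → Traj S A k) : ℝ :=
  -∑ i, ∑ t, Real.log (π.dens (D i t).1 (returnToGo (D i) t) (D i t).2.1)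

end CondPolicy

namespace MDP

variable {S : Type u} {A : Type v} [MeasurableSpace S] [MeasurableSpace A]

attribute [instance] MDP.init_prob MDP.step_markov

/-- One step of `M` from `(s, a)`, giving `(r, s')`, followed by `κ` from `s'`. -/
def stepThen (M : MDP S A) {Ω : Type*} [MeasurableSpace Ω] (κ : Kernel S Ω) :
    Kernel (S × A) ((ℝ × S) × Ω) :=
  M.step ⊗ₖ κ.comap (fun q : (S × A) × (ℝ × S) => q.2.2) (by fun_prop)

/-- The law of the next `k` steps when following the policy `π` from a given state. -/
def rollout (M : MDP S A) (π : Kernel S A) : (k : ℕ) → Kernel S (Traj S A k)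
  | 0 => Kernel.const S (Measure.dirac Fin.elim0)
  | k + 1 =>
    (Kernel.id ×ₖ (π ⊗ₖ M.stepThen (M.rollout π k))).map
      fun x : S × (A × ((ℝ × S) × Traj S A k)) =>
        (Fin.cons (x.1, x.2.1, x.2.2.1.1) x.2.2.2 : Traj S A (k + 1))

/-- The law `P_π` of the whole trajectory. -/
def traj (M : MDP S A) (π : Kernel S A) : Measure (Traj S A M.horizon) :=
  M.init.bind (M.rollout π M.horizon)

/-- The expected return `J(π)`. -/
def J (M : MDP S A) (π : Kernel S A) : ℝ :=
  ∫ τ, totalReturn τ ∂(M.traj π)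

/-- `π` is an optimal policy. -/
def IsOptimal (M : MDP S A) (π : Kernel S A) : Prop :=
  IsMarkovKernel π ∧ ∀ π' : Kernel S A, IsMarkovKernel π' → M.J π' ≤ M.J π

/-- The marginal `P_π(s)` on states (timestep uniform in `1, …, H`). -/
def occ (M : MDP S A) (π : Kernel S A) : Measure S :=
  (M.horizon : ℝ≥0∞)⁻¹ • ∑ t, (M.traj π).map fun τ => (τ t).1

/-- The joint law `P_π((s, g), a)` of state, return-to-go and action
(timestep uniform in `1, …, H`). -/
def joint (M : MDP S A) (π : Kernel S A) : Measure ((S × ℝ) × A) :=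
  (M.horizon : ℝ≥0∞)⁻¹ •
    ∑ t, (M.traj π).map fun τ => (((τ t).1, returnToGo τ t), (τ t).2.1)

/-- `P_π(g = y | s)`: the probability that the return obtained from `s`, at timestep `t(s)`, to
the end is `y`. -/
def returnProb (M : MDP S A) (π : Kernel S A) (s : S) (y : ℝ) : ℝ≥0∞ :=
  M.rollout π (M.horizon - M.time s + 1) s {τ | totalReturn τ = y}

/-- `P_π(g = y | s, a)`. -/
def returnProbAction (M : MDP S A) (π : Kernel S A) (s : S) (a : A) (y : ℝ) : ℝ≥0∞ :=
  M.stepThen (M.rollout π (M.horizon - M.time s)) (s, a) {x | x.1.1 + totalReturn x.2 = y}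

open Classical in
/-- The infinite-data policy
`π_f(a | s) = β(a | s) P_β(g = f(s) | s, a) / P_β(g = f(s) | s)`. Where the denominator vanishes
the formula is meaningless and the policy is set to `β`. -/
def rcsl (M : MDP S A) (β : Kernel S A) [IsSFiniteKernel β] (f : S → ℝ) : Kernel S A :=
  Kernel.withDensity β fun s a =>
    if M.returnProb β s (f s) = 0 then 1
    else M.returnProbAction β s a (f s) / M.returnProb β s (f s)

lemma measurable_cons (k : ℕ) :
    Measurable fun x : S × (A × ((ℝ × S) × Traj S A k)) =>
      (Fin.cons (x.1, x.2.1, x.2.2.1.1) x.2.2.2 : Traj S A (k + 1)) := by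
  refine measurable_pi_lambda _ fun i => ?_
  refine Fin.cases ?_ (fun j => ?_) i
  · simp only [Fin.cons_zero]; fun_prop
  · simp only [Fin.cons_succ]; fun_prop

lemma measurable_totalReturn (k : ℕ) :
    Measurable (totalReturn : Traj S A k → ℝ) := by
  unfold totalReturn; fun_prop

instance (M : MDP S A) {Ω : Type*} [MeasurableSpace Ω] (κ : Kernel S Ω) [IsMarkovKernel κ] :
    IsMarkovKernel (M.stepThen κ) := by
  unfold stepThen; infer_instance

instance isMarkovKernel_rollout (M : MDP S A) (π : Kernel S A) [IsMarkovKernel π] (k : ℕ) :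
    IsMarkovKernel (M.rollout π k) := by
  induction k with
  | zero => unfold rollout; infer_instance
  | succ k ih => unfold rollout; exact Kernel.IsMarkovKernel.map _ (measurable_cons k)

instance (M : MDP S A) (π : Kernel S A) [IsMarkovKernel π] :
    IsProbabilityMeasure (M.traj π) := by
  unfold traj; infer_instance

instance (M : MDP S A) (π : Kernel S A) [IsMarkovKernel π] : IsFiniteMeasure (M.joint π) := by
  unfold joint
  have h : (M.horizon : ℝ≥0∞)⁻¹ ≠ ⊤ := by simpa using M.horizon_pos.ne'
  exact Measure.smul_finite _ h

lemma measurable_returnProb (M : MDP S A) (β : Kernel S A) [IsMarkovKernel β] {f : S → ℝ}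
    (hf : Measurable f) : Measurable fun s => M.returnProb β s (f s) := by
  have h : ∀ k, Measurable fun s => M.rollout β (k + 1) s {τ | totalReturn τ = f s} := fun k =>
    Kernel.measurable_kernel_prodMk_left (κ := M.rollout β (k + 1))
      (t := {p : S × Traj S A (k + 1) | totalReturn p.2 = f p.1})
      (measurableSet_eq_fun ((measurable_totalReturn _).comp measurable_snd)
        (hf.comp measurable_fst))
  have h2 : Measurable fun p : S × ℕ => M.rollout β (p.2 + 1) p.1 {τ | totalReturn τ = f p.1} :=
    measurable_from_prod_countable_left h
  exact h2.comp (measurable_id.prodMk (measurable_const.sub M.time_measurable))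

lemma measurable_returnProbAction (M : MDP S A) (β : Kernel S A) [IsMarkovKernel β] {f : S → ℝ}
    (hf : Measurable f) : Measurable fun p : S × A => M.returnProbAction β p.1 p.2 (f p.1) := by
  have h : ∀ k, Measurable fun p : S × A => M.stepThen (M.rollout β k) p
      {x | x.1.1 + totalReturn x.2 = f p.1} := fun k =>
    Kernel.measurable_kernel_prodMk_left (κ := M.stepThen (M.rollout β k))
      (t := {q : (S × A) × ((ℝ × S) × Traj S A k) | q.2.1.1 + totalReturn q.2.2 = f q.1.1})
      (measurableSet_eq_fun ((by fun_prop : Measurable fun q : (S × A) × ((ℝ × S) × Traj S A k) => q.2.1.1).add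
        ((measurable_totalReturn _).comp (by fun_prop))) (hf.comp (by fun_prop)))
  have h2 : Measurable fun q : (S × A) × ℕ => M.stepThen (M.rollout β q.2) q.1
      {x | x.1.1 + totalReturn x.2 = f q.1.1} :=
    measurable_from_prod_countable_left h
  exact h2.comp (measurable_id.prodMk (measurable_const.sub (M.time_measurable.comp measurable_fst)))

lemma lintegral_returnProbAction (M : MDP S A) (β : Kernel S A) [IsMarkovKernel β] (s : S)
    (y : ℝ) : ∫⁻ a, M.returnProbAction β s a y ∂(β s) = M.returnProb β s y := by
  unfold returnProbAction returnProb
  generalize M.horizon - M.time s = k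
  have hm : MeasurableSet {τ : Traj S A (k+1) | totalReturn τ = y} :=
    measurable_totalReturn _ (measurableSet_singleton y)
  rw [rollout, Kernel.map_apply' _ (measurable_cons k) _ hm, Kernel.prod_apply,
    Kernel.id_apply, Measure.prod_apply (measurable_cons k hm), lintegral_dirac' _
     (measurable_measure_prodMk_left (measurable_cons k hm)), Kernel.compProd_apply]
  · simp [Set.preimage, totalReturn, Fin.sum_univ_succ]
  · exact measurable_prodMk_left (measurable_cons k hm)

/-- The infinite-data policy is a genuine policy. -/
theorem isMarkovKernel_rcsl (M : MDP S A) (β : Kernel S A) [IsMarkovKernel β] {f : S → ℝ}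
    (hf : Measurable f) : IsMarkovKernel (M.rcsl β f) := by
  classical
  have h1 := M.measurable_returnProb β hf
  have h2 := M.measurable_returnProbAction β hf
  refine ⟨fun s => ⟨?_⟩⟩
  unfold rcsl
  rw [Kernel.withDensity_apply' _ _ s Set.univ, setLIntegral_univ]
  · by_cases h : M.returnProb β s (f s) = 0
    · simp [h]
    · have hne : M.returnProb β s (f s) ≠ ⊤ := measure_ne_top _ _
      simp only [h, if_false, div_eq_mul_inv]
      rw [lintegral_mul_const', M.lintegral_returnProbAction, ENNReal.mul_inv_cancel h hne]
      simpa using h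
  · refine Measurable.ite ?_ measurable_const (h2.div (h1.comp measurable_fst))
    exact (h1.comp measurable_fst) (measurableSet_singleton 0)

/-- The conditional law `P_π(a | s, g)`. -/
def condAction [StandardBorelSpace A] [Nonempty A] (M : MDP S A) (π : Kernel S A)
    [IsMarkovKernel π] : Kernel (S × ℝ) A :=
  (M.joint π).condKernel

/-- The expected loss
`L(π) = E_{s ∼ P_β} E_{g ∼ P_β(· | s)} KL(P_β(· | s, g) ‖ π(· | s, g))`. -/
def loss [StandardBorelSpace A] [Nonempty A] (M : MDP S A) (β : Kernel S A) [IsMarkovKernel β]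
    {ν : Measure A} [SFinite ν] (π : CondPolicy S A ν) : ℝ≥0∞ :=
  ∫⁻ p, InformationTheory.klDiv (M.condAction β p) (π.toKernel p) ∂(M.joint β).fst

/-- Near determinism: `P(r ≠ ρ(s, a) or s' ≠ T(s, a) | s, a) ≤ ε` at all `s, a`. -/
def NearlyDeterministic (M : MDP S A) (T : S → A → S) (ρ : S → A → ℝ) (ε : ℝ) : Prop :=
  ∀ s a, (M.step (s, a)).real {p | p.1 ≠ ρ s a ∨ p.2 ≠ T s a} ≤ ε

/-- Consistency: `f(s) = f(s') + r` at every transition before the last timestep. -/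
def Consistent (M : MDP S A) (f : S → ℝ) : Prop :=
  ∀ s a, M.time s < M.horizon → ∀ᵐ p ∂(M.step (s, a)), f s = f p.2 + p.1

/-- Return coverage: `P_β(g = f(s) | s) ≥ α` for all states `s` visited under `β`. -/
def Covers (M : MDP S A) (β : Kernel S A) (f : S → ℝ) (α : ℝ) : Prop :=
  ∀ᵐ s ∂(M.occ β), α ≤ (M.returnProb β s (f s)).toReal

/-- The return from `s` over the whole horizon when the stationary rule `σ` is followed under the
deterministic dynamics `T` and rewards `ρ`. -/
def detReturn (M : MDP S A) (T : S → A → S) (ρ : S → A → ℝ) (σ : S → A) (s : S) : ℝ :=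
  ∑ t ∈ Finset.range M.horizon,
    ρ ((fun x => T x (σ x))^[t] s) (σ ((fun x => T x (σ x))^[t] s))

end MDP

/-- `π` minimizes the empirical loss over the policy class `C`. -/
def IsERM {S : Type u} {A : Type v} [MeasurableSpace S] [MeasurableSpace A] {ν : Measure A}
    (C : Finset (CondPolicy S A ν)) {N k : ℕ} (D : Fin N → Traj S A k) (π : CondPolicy S A ν) :
    Prop :=
  π ∈ C ∧ ∀ π' ∈ C, π.empiricalLoss D ≤ π'.empiricalLoss D

end

noncomputable section

/-! The infinite-data policy `rcsl` sits between the optimal deterministic policy and the learned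
one, and each gap is bounded separately.

Optimal policy against `rcsl`. A deterministic policy gains at most `ε H²` over its return under
`T`, `ρ`, so `E f(s₁)` nearly dominates `J(π*)`. Consistency of `f` telescopes: a trajectory can
miss the target `f(s₁)` only through its last reward. At the last timestep `rcsl` reweights `β` by
`P(r = f(s) | s, a)`, and either this or its complement is at most `ε`, so a miss has probability at
most `ε / α`. This is `lintegral_init_le_value_rcsl`.

`rcsl` against the learned policy. The performance difference inequality `value_le_value_add_visits`
bounds the gap by positive parts of action-value differences along `rcsl`, and the occupancy bound
moves these to states of `β`. After multiplication by `P_β(g = f(s) | s)`, the law `rcsl` becomes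
the joint law of state and action under `β` on the event `g = f(s)`. There the comparison is between
`P_β(· | s, g)` and `π(· | s, g)`, which Pinsker's inequality controls by the loss
(`mul_lintegral_occ_sub_le`). Pinsker is used in the linear form `l · KL + 1 / l`, so that it
integrates directly, without Jensen; `l` is optimized only at the end and produces the square root
of the loss.

Loss of the learned policy. The difference of two losses is an expected log-likelihood ratio
(`loss_add_le`). Hoeffding's inequality over the independent trajectories and a union bound over the
class bound it for every empirical minimizer (`one_sub_le_measureReal_isERM`). Values and gaps are
lower integrals in `ℝ≥0∞`, where truncated subtraction is the positive part. -/

lemma returnToGo_cons_succ {S : Type u} {A : Type v} {k : ℕ} (x : S × A × ℝ) (τ : Traj S A k)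
    (t : Fin k) : returnToGo (Fin.cons x τ : Traj S A (k + 1)) t.succ = returnToGo τ t := by
  unfold returnToGo
  rw [← Fin.map_succEmb_Ici, Finset.sum_map]
  simp only [Fin.coe_succEmb, Fin.cons_succ]

lemma returnToGo_cons_zero {S : Type u} {A : Type v} {k : ℕ} (x : S × A × ℝ) (τ : Traj S A k) :
    returnToGo (Fin.cons x τ : Traj S A (k + 1)) 0 = x.2.2 + totalReturn τ := by
  unfold returnToGo totalReturn
  have : Finset.Ici (0 : Fin (k + 1)) = Finset.univ := by ext; simp
  rw [this, Fin.sum_univ_succ]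
  simp only [Fin.cons_zero, Fin.cons_succ]

namespace MDP

variable {S : Type u} {A : Type v} [MeasurableSpace S] [MeasurableSpace A]

/-! ### Rollouts, values, occupancy and the performance difference inequality. -/

section Rollout

variable (M : MDP S A) (π : Kernel S A)

/-- The expected sum of the nonnegative parts of the next `k` rewards under `π`. -/
def value (k : ℕ) (s : S) : ℝ≥0∞ :=
  ∫⁻ τ, ∑ j, ENNReal.ofReal (τ j).2.2 ∂M.rollout π k s

/-- The expected sum of rewards when taking the action `a` and then following `π` for `k` steps. -/
def actionValue (k : ℕ) (s : S) (a : A) : ℝ≥0∞ :=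
  ∫⁻ p, ENNReal.ofReal p.1 + M.value π k p.2 ∂M.step (s, a)

/-- The expected sum of `b` over the next `k` states visited under `π`. -/
def visits (b : S → ℝ≥0∞) (k : ℕ) (s : S) : ℝ≥0∞ :=
  ∫⁻ τ, ∑ j, b (τ j).1 ∂M.rollout π k s

@[fun_prop]
lemma measurable_value (k : ℕ) : Measurable (M.value π k) :=
  Measurable.lintegral_kernel (by fun_prop)

lemma measurable_visits {b : S → ℝ≥0∞} (hb : Measurable b) (k : ℕ) :
    Measurable (M.visits π b k) :=
  Measurable.lintegral_kernel (by fun_prop)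

lemma measurable_actionValue (k : ℕ) :
    Measurable fun q : S × A => M.actionValue π k q.1 q.2 :=
  Measurable.lintegral_kernel (κ := M.step) (by fun_prop)

/-- Passes between the recursive quantities `visits` and averages over the occupancy; the uniform
timestep accounts for the factor `H`. -/
lemma lintegral_occ {b : S → ℝ≥0∞} (hb : Measurable b) :
    M.horizon * ∫⁻ s, b s ∂M.occ π = ∫⁻ s, M.visits π b M.horizon s ∂M.init := by
  have h0 : (M.horizon : ℝ≥0∞) ≠ 0 := by simpa using M.horizon_pos.ne'
  unfold occ visits
  rw [lintegral_smul_measure, smul_eq_mul, ← mul_assoc,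
    ENNReal.mul_inv_cancel h0 (ENNReal.natCast_ne_top _), one_mul, lintegral_finsetSum_measure]
  have hm : ∀ t, Measurable fun τ : Traj S A M.horizon => (τ t).1 := fun t => by fun_prop
  simp_rw [lintegral_map hb (hm _)]
  rw [← lintegral_finsetSum _ (by fun_prop), traj,
    Measure.lintegral_bind (Kernel.aemeasurable _)
      (by fun_prop : Measurable fun τ : Traj S A M.horizon => ∑ t, b (τ t).1).aemeasurable]

lemma lintegral_joint {φ : (S × ℝ) × A → ℝ≥0∞} (hφ : Measurable φ) :
    M.horizon * ∫⁻ q, φ q ∂M.joint π =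
      ∫⁻ s, ∫⁻ τ, ∑ t, φ (((τ t).1, returnToGo τ t), (τ t).2.1) ∂M.rollout π M.horizon s
        ∂M.init := by
  have h0 : (M.horizon : ℝ≥0∞) ≠ 0 := by simpa using M.horizon_pos.ne'
  have hm : ∀ t, Measurable fun τ : Traj S A M.horizon =>
      (((τ t).1, returnToGo τ t), (τ t).2.1) := fun t => by unfold returnToGo; fun_prop
  have hφm : ∀ t, Measurable fun τ : Traj S A M.horizon =>
      φ (((τ t).1, returnToGo τ t), (τ t).2.1) := fun t => hφ.comp (hm t)
  unfold joint
  rw [lintegral_smul_measure, smul_eq_mul, ← mul_assoc,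
    ENNReal.mul_inv_cancel h0 (ENNReal.natCast_ne_top _), one_mul, lintegral_finsetSum_measure]
  simp_rw [lintegral_map hφ (hm _)]
  rw [← lintegral_finsetSum _ fun t _ => hφm t, traj,
    Measure.lintegral_bind (Kernel.aemeasurable _)]
  exact (Finset.measurable_sum _ fun t _ => hφm t).aemeasurable

/-- The action value of `π` up to the horizon, at the timestep of the state. -/
def remainingActionValue (s : S) (a : A) : ℝ≥0∞ :=
  M.actionValue π (M.horizon - M.time s) s a

lemma measurable_remainingActionValue :
    Measurable fun q : S × A => M.remainingActionValue π q.1 q.2 := by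
  have h : Measurable fun q : (S × A) × ℕ => M.actionValue π q.2 q.1.1 q.1.2 :=
    measurable_from_prod_countable_left fun k => M.measurable_actionValue π k
  exact h.comp (measurable_id.prodMk
    (measurable_const.sub (M.time_measurable.comp measurable_fst)))

variable [IsMarkovKernel π]

lemma lintegral_stepThen {Ω : Type*} [MeasurableSpace Ω] (κ : Kernel S Ω) [IsMarkovKernel κ]
    {F : (ℝ × S) × Ω → ℝ≥0∞} (hF : Measurable F) (q : S × A) :
    ∫⁻ x, F x ∂M.stepThen κ q = ∫⁻ p, ∫⁻ ω, F (p, ω) ∂κ p.2 ∂M.step q := by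
  unfold stepThen
  rw [Kernel.lintegral_compProd _ _ _ hF]
  rfl

lemma lintegral_rollout_succ (k : ℕ) {F : Traj S A (k + 1) → ℝ≥0∞} (hF : Measurable F) (s : S) :
    ∫⁻ τ, F τ ∂M.rollout π (k + 1) s =
      ∫⁻ a, ∫⁻ x, F (Fin.cons (s, a, x.1.1) x.2) ∂M.stepThen (M.rollout π k) (s, a) ∂π s := by
  have hc : Measurable fun x : S × (A × ((ℝ × S) × Traj S A k)) =>
      F (Fin.cons (x.1, x.2.1, x.2.2.1.1) x.2.2.2) := hF.comp (measurable_cons k)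
  rw [rollout, Kernel.map_apply _ (measurable_cons k), lintegral_map hF (measurable_cons k),
    Kernel.lintegral_id_prod hc, Kernel.lintegral_compProd _ _ _
      (f := fun x : A × ((ℝ × S) × Traj S A k) => F (Fin.cons (s, x.1, x.2.1.1) x.2.2))
      (hc.comp measurable_prodMk_left)]

lemma lintegral_rollout_succ' (k : ℕ) {F : Traj S A (k + 1) → ℝ≥0∞} (hF : Measurable F) (s : S) :
    ∫⁻ τ, F τ ∂M.rollout π (k + 1) s =
      ∫⁻ a, ∫⁻ p, ∫⁻ τ, F (Fin.cons (s, a, p.1) τ) ∂M.rollout π k p.2 ∂M.step (s, a) ∂π s := by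
  rw [M.lintegral_rollout_succ π k hF]
  refine lintegral_congr fun a => ?_
  rw [M.lintegral_stepThen]
  exact (hF.comp (measurable_cons k)).comp
    (by fun_prop : Measurable fun x : (ℝ × S) × Traj S A k => (s, a, x))

@[simp] lemma value_zero (s : S) : M.value π 0 s = 0 := by simp [value]

@[simp] lemma visits_zero (b : S → ℝ≥0∞) (s : S) : M.visits π b 0 s = 0 := by simp [visits]

lemma value_succ (k : ℕ) (s : S) :
    M.value π (k + 1) s = ∫⁻ a, M.actionValue π k s a ∂π s := by
  unfold value
  rw [M.lintegral_rollout_succ' π k (by fun_prop)]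
  refine lintegral_congr fun a => lintegral_congr fun p => ?_
  simp [Fin.sum_univ_succ, lintegral_add_left, value]

lemma visits_succ {b : S → ℝ≥0∞} (hb : Measurable b) (k : ℕ) (s : S) :
    M.visits π b (k + 1) s = b s + ∫⁻ a, ∫⁻ p, M.visits π b k p.2 ∂M.step (s, a) ∂π s := by
  unfold visits
  rw [M.lintegral_rollout_succ' π k (by fun_prop)]
  simp [Fin.sum_univ_succ, lintegral_add_left]

lemma value_le (k : ℕ) (s : S) : M.value π k s ≤ k := by
  induction k generalizing s with
  | zero => simp
  | succ k ih =>
    rw [value_succ]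
    have h : ∀ a, M.actionValue π k s a ≤ (k + 1 : ℕ) := fun a => by
      calc M.actionValue π k s a ≤ ∫⁻ _, ((k + 1 : ℕ) : ℝ≥0∞) ∂M.step (s, a) := by
            refine lintegral_mono_ae ?_
            filter_upwards [M.reward_mem s a] with p hp
            push_cast
            rw [add_comm]
            exact add_le_add (ih _) (ENNReal.ofReal_le_one.2 hp.2)
        _ = _ := by simp
    calc _ ≤ ∫⁻ _, ((k + 1 : ℕ) : ℝ≥0∞) ∂π s := lintegral_mono h
      _ = _ := by simp

lemma actionValue_le (k : ℕ) (s : S) (a : A) : M.actionValue π k s a ≤ (k + 1 : ℕ) := by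
  calc M.actionValue π k s a ≤ ∫⁻ _, ((k + 1 : ℕ) : ℝ≥0∞) ∂M.step (s, a) := by
        refine lintegral_mono_ae ?_
        filter_upwards [M.reward_mem s a] with p hp
        push_cast
        rw [add_comm]
        exact add_le_add (M.value_le π k _) (ENNReal.ofReal_le_one.2 hp.2)
    _ = _ := by simp

lemma isProbabilityMeasure_occ : IsProbabilityMeasure (M.occ π) := by
  refine ⟨?_⟩
  have h := M.lintegral_occ π (b := fun _ => 1) measurable_const
  have h0 : (M.horizon : ℝ≥0∞) ≠ 0 := by simpa using M.horizon_pos.ne'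
  simp only [visits, lintegral_const, measure_univ, Finset.sum_const, Finset.card_univ,
    Fintype.card_fin, nsmul_eq_mul, mul_one, one_mul] at h
  exact (ENNReal.mul_right_inj h0 (ENNReal.natCast_ne_top _)).1 (by simpa using h)

/-- An expectation over the next state only depends on the values at the next timestep. -/
lemma lintegral_step_mono {s : S} (hs : M.time s < M.horizon) {F G : ℝ × S → ℝ≥0∞}
    (h : ∀ p : ℝ × S, M.time p.2 = M.time s + 1 → F p ≤ G p) (a : A) :
    ∫⁻ p, F p ∂M.step (s, a) ≤ ∫⁻ p, G p ∂M.step (s, a) :=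
  lintegral_mono_ae (by filter_upwards [M.step_time s a hs] with p hp using h p hp)

/-- Performance difference inequality. -/
theorem value_le_value_add_visits (π' : Kernel S A) [IsMarkovKernel π'] (k : ℕ) (s : S)
    (hs : k = 0 ∨ M.time s + k = M.horizon + 1) :
    M.value π k s ≤ M.value π' k s + M.visits π (fun s =>
      ∫⁻ a, M.remainingActionValue π' s a ∂π s - ∫⁻ a, M.remainingActionValue π' s a ∂π' s)
      k s := by
  have hm := M.measurable_remainingActionValue π'
  have hb : Measurable fun s =>
      ∫⁻ a, M.remainingActionValue π' s a ∂π s - ∫⁻ a, M.remainingActionValue π' s a ∂π' s :=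
    (Measurable.lintegral_kernel_prod_right' hm).sub (Measurable.lintegral_kernel_prod_right' hm)
  induction k generalizing s with
  | zero => simp
  | succ k ih =>
    replace hs : M.time s + (k + 1) = M.horizon + 1 := by simpa using hs
    -- Here `k + 1` counts the remaining steps including the one at `s`, so `k` steps follow it, as
    -- in `remainingActionValue`.
    have hk : M.horizon - M.time s = k := by omega
    set b := fun s =>
      ∫⁻ a, M.remainingActionValue π' s a ∂π s - ∫⁻ a, M.remainingActionValue π' s a ∂π' s with hbd
    have hv := M.measurable_visits π hb k
    have hstep : ∀ a, M.actionValue π k s a ≤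
        M.actionValue π' k s a + ∫⁻ p, M.visits π b k p.2 ∂M.step (s, a) := by
      intro a
      unfold actionValue
      rw [← lintegral_add_left (by fun_prop)]
      -- After the last timestep nothing is known about the time of the next state, but no steps
      -- remain either.
      rcases Nat.eq_zero_or_pos k with rfl | hk0
      · simp
      · refine M.lintegral_step_mono (by omega) (fun p hp => ?_) a
        rw [add_assoc]
        gcongr
        exact ih _ (Or.inr (by omega))
    rw [value_succ, value_succ, visits_succ _ _ hb]
    calc _ ≤ ∫⁻ a, M.actionValue π' k s a + ∫⁻ p, M.visits π b k p.2 ∂M.step (s, a) ∂π s :=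
          lintegral_mono hstep
      _ = ∫⁻ a, M.actionValue π' k s a ∂π s +
          ∫⁻ a, ∫⁻ p, M.visits π b k p.2 ∂M.step (s, a) ∂π s :=
          lintegral_add_left ((M.measurable_actionValue π' k).comp measurable_prodMk_left) _
      _ ≤ _ := by
          rw [← add_assoc]
          gcongr
          simp only [hbd, remainingActionValue, hk]
          -- Truncated subtraction replaces the signed gap of the usual identity by its positive
          -- part, hence an inequality.
          exact le_add_tsub

open Classical in
/-- Summing over the states of a rollout whose return-to-go agrees with `f`. -/
theorem lintegral_rollout_sum_returnToGo_eq {f : S → ℝ} (hf : Measurable f) {ψ : S × A → ℝ≥0∞}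
    (hψ : Measurable ψ) (k : ℕ) (s : S) (hs : k = 0 ∨ M.time s + k = M.horizon + 1) :
    ∫⁻ τ, ∑ t, (if returnToGo τ t = f (τ t).1 then ψ ((τ t).1, (τ t).2.1) else 0)
        ∂M.rollout π k s =
      M.visits π (fun s => ∫⁻ a, ψ (s, a) * M.returnProbAction π s a (f s) ∂π s) k s := by
  have hm := M.measurable_returnProbAction π hf
  have hb : Measurable fun s => ∫⁻ a, ψ (s, a) * M.returnProbAction π s a (f s) ∂π s :=
    Measurable.lintegral_kernel_prod_right' (hψ.mul hm)
  have hF : ∀ k, ∀ t : Fin k, Measurable fun τ : Traj S A k =>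
      (if returnToGo τ t = f (τ t).1 then ψ ((τ t).1, (τ t).2.1) else 0) := fun k t => by
    refine Measurable.ite (measurableSet_eq_fun ?_ (by fun_prop)) (by fun_prop) (by fun_prop)
    unfold returnToGo; fun_prop
  induction k generalizing s with
  | zero => simp
  | succ k ih =>
    replace hs : M.time s + (k + 1) = M.horizon + 1 := by simpa using hs
    have hk : M.horizon - M.time s = k := by omega
    set b := fun s => ∫⁻ a, ψ (s, a) * M.returnProbAction π s a (f s) ∂π s with hbd
    -- Markov property: given `s` and `a`, the first summand sees the return event with probability
    -- `returnProbAction`, and the others belong to a rollout from the next state.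
    have hcons : ∀ a, ∫⁻ x, ∑ t, (if returnToGo (Fin.cons (s, a, x.1.1) x.2 : Traj S A (k + 1)) t =
          f ((Fin.cons (s, a, x.1.1) x.2 : Traj S A (k + 1)) t).1 then
          ψ (((Fin.cons (s, a, x.1.1) x.2 : Traj S A (k + 1)) t).1,
            ((Fin.cons (s, a, x.1.1) x.2 : Traj S A (k + 1)) t).2.1) else 0)
          ∂M.stepThen (M.rollout π k) (s, a) =
        ψ (s, a) * M.returnProbAction π s a (f s) +
          ∫⁻ p, M.visits π b k p.2 ∂M.step (s, a) := by
      intro a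
      have hset : MeasurableSet {x : (ℝ × S) × Traj S A k | x.1.1 + totalReturn x.2 = f s} :=
        measurableSet_eq_fun ((by fun_prop : Measurable fun x : (ℝ × S) × Traj S A k => x.1.1).add
          ((measurable_totalReturn k).comp measurable_snd)) measurable_const
      simp only [Fin.sum_univ_succ, returnToGo_cons_zero, returnToGo_cons_succ, Fin.cons_zero,
        Fin.cons_succ]
      rw [lintegral_add_left (Measurable.ite hset measurable_const measurable_const)]
      congr 1
      · have : (fun x : (ℝ × S) × Traj S A k =>
            if x.1.1 + totalReturn x.2 = f s then ψ (s, a) else 0) =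
            {x | x.1.1 + totalReturn x.2 = f s}.indicator fun _ => ψ (s, a) := by
          ext x; simp [Set.indicator]
        rw [this, lintegral_indicator_const hset, returnProbAction, hk]
      · rw [M.lintegral_stepThen _ 
          (F := fun x : (ℝ × S) × Traj S A k => ∑ t, if returnToGo x.2 t = f (x.2 t).1 then
            ψ ((x.2 t).1, (x.2 t).2.1) else 0)
          ((Finset.measurable_sum _ fun t _ => hF k t).comp measurable_snd)]
        rcases Nat.eq_zero_or_pos k with rfl | hk0
        · simp
        · refine lintegral_congr_ae ?_
          filter_upwards [M.step_time s a (by omega)] with p hp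
          exact ih _ (Or.inr (by omega))
    rw [visits_succ _ _ hb, M.lintegral_rollout_succ π k (Finset.measurable_sum _ fun t _ => hF _ t)]
    simp_rw [hcons]
    exact lintegral_add_left ((hψ.mul hm).comp measurable_prodMk_left) _

/-- The joint law of state, return and action on the event that the return is `f`. -/
theorem lintegral_joint_indicator {f : S → ℝ} (hf : Measurable f) {ψ : S × A → ℝ≥0∞}
    (hψ : Measurable ψ) :
    ∫⁻ q in {q | q.1.2 = f q.1.1}, ψ (q.1.1, q.2) ∂M.joint π =
      ∫⁻ s, ∫⁻ a, ψ (s, a) * M.returnProbAction π s a (f s) ∂π s ∂M.occ π := by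
  classical
  have h0 : (M.horizon : ℝ≥0∞) ≠ 0 := by simpa using M.horizon_pos.ne'
  have hset : MeasurableSet {q : (S × ℝ) × A | q.1.2 = f q.1.1} :=
    measurableSet_eq_fun (by fun_prop) (by fun_prop)
  have hψ' : Measurable fun q : (S × ℝ) × A => ψ (q.1.1, q.2) := by fun_prop
  refine (ENNReal.mul_right_inj h0 (ENNReal.natCast_ne_top _)).1 ?_
  rw [← lintegral_indicator hset, M.lintegral_joint π (hψ'.indicator hset),
    M.lintegral_occ π (b := fun s => ∫⁻ a, ψ (s, a) * M.returnProbAction π s a (f s) ∂π s)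
      (Measurable.lintegral_kernel_prod_right'
      (hψ.mul (M.measurable_returnProbAction π hf)))]
  refine lintegral_congr_ae ?_
  filter_upwards [M.init_time] with s hs
  rw [← M.lintegral_rollout_sum_returnToGo_eq π hf hψ _ s (Or.inr (by omega))]
  simp [Set.indicator]

end Rollout

end MDP

/-! ### Near determinism. -/

/-- The exceptional set need not be measurable, so it is replaced by a measurable hull of the same
measure. -/
lemma lintegral_le_add_mul_measure {Ω : Type*} [MeasurableSpace Ω] (μ : Measure Ω)
    [IsProbabilityMeasure μ] {F : Ω → ℝ≥0∞} {E : Set Ω} {a B : ℝ≥0∞}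
    (hE : ∀ x ∉ E, F x ≤ a) (hB : ∀ᵐ x ∂μ, F x ≤ B) : ∫⁻ x, F x ∂μ ≤ a + B * μ E := by
  have hm := measurableSet_toMeasurable μ E
  calc ∫⁻ x, F x ∂μ ≤ ∫⁻ x, a + (toMeasurable μ E).indicator (fun _ => B) x ∂μ := by
        refine lintegral_mono_ae ?_
        filter_upwards [hB] with x hx
        by_cases h : x ∈ toMeasurable μ E
        · simpa [h] using hx.trans le_add_self
        · simpa [h] using hE x fun h' => h (subset_toMeasurable μ E h')
    _ = a + B * μ E := by
        rw [lintegral_add_left measurable_const, lintegral_indicator_const hm,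
          measure_toMeasurable]
        simp

namespace MDP

variable {S : Type u} {A : Type v} [MeasurableSpace S] [MeasurableSpace A]

section NearDeterminism

variable {M : MDP S A} {T : S → A → S} {ρ : S → A → ℝ} {ε : ℝ}

lemma NearlyDeterministic.step_le (h : M.NearlyDeterministic T ρ ε) (s : S) (a : A) :
    M.step (s, a) {p | p.1 ≠ ρ s a ∨ p.2 ≠ T s a} ≤ ENNReal.ofReal ε := by
  rw [← ENNReal.ofReal_toReal (measure_ne_top _ _)]
  exact ENNReal.ofReal_le_ofReal (h s a)

/-- If `ρ s a` lay outside `[0, 1]`, the reward would differ from it almost surely, an event of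
probability at most `ε < 1`. -/
lemma NearlyDeterministic.mem_Icc (h : M.NearlyDeterministic T ρ ε) (hε : ε < 1) (s : S) (a : A) :
    ρ s a ∈ Set.Icc (0 : ℝ) 1 := by
  by_contra hc
  have h1 : ∀ᵐ p ∂M.step (s, a), p ∈ {p : ℝ × S | p.1 ≠ ρ s a ∨ p.2 ≠ T s a} := by
    filter_upwards [M.reward_mem s a] with p hp
    exact Or.inl fun he => hc (he ▸ hp)
  have h2 := h.step_le s a
  replace h1 := measure_congr (Filter.eventuallyEq_univ.2 h1)
  rw [measure_univ] at h1
  rw [show M.step (s, a) {p | p.1 ≠ ρ s a ∨ p.2 ≠ T s a} = 1 from h1] at h2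
  exact absurd h2 (by simpa using hε)

/-- The value of a deterministic policy exceeds its return under the deterministic dynamics by
little. -/
theorem NearlyDeterministic.value_deterministic_le (h : M.NearlyDeterministic T ρ ε) (hε : ε < 1)
    {σ : S → A} (hσ : Measurable σ) (k : ℕ) (s : S) :
    M.value (Kernel.deterministic σ hσ) k s ≤
      ENNReal.ofReal (∑ t ∈ Finset.range k,
        ρ ((fun x => T x (σ x))^[t] s) (σ ((fun x => T x (σ x))^[t] s))) +
      ENNReal.ofReal ε * (k : ℝ≥0∞) ^ 2 := by
  have hρ := h.mem_Icc hε
  induction k generalizing s with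
  | zero => simp
  | succ k ih =>
    rw [value_succ, Kernel.lintegral_deterministic'
      (f := fun a => M.actionValue (Kernel.deterministic σ hσ) k s a) _
      ((M.measurable_actionValue _ k).comp measurable_prodMk_left), Finset.sum_range_succ',
      ENNReal.ofReal_add (Finset.sum_nonneg fun t _ => (hρ _ _).1) (hρ _ _).1]
    simp only [Function.iterate_succ_apply, Function.iterate_zero, id_eq]
    set D := ENNReal.ofReal (∑ t ∈ Finset.range k,
        ρ ((fun x => T x (σ x))^[t] (T s (σ s))) (σ ((fun x => T x (σ x))^[t] (T s (σ s)))))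
    -- Off the exceptional event the step is the deterministic one and the induction hypothesis
    -- applies; on it, the trivial bound `k + 1` is paid with probability at most `ε`.
    have h1 := lintegral_le_add_mul_measure (M.step (s, σ s))
      (F := fun p => ENNReal.ofReal p.1 + M.value (Kernel.deterministic σ hσ) k p.2)
      (E := {p | p.1 ≠ ρ s (σ s) ∨ p.2 ≠ T s (σ s)})
      (a := ENNReal.ofReal (ρ s (σ s)) + (D + ENNReal.ofReal ε * (k : ℝ≥0∞) ^ 2))
      (B := k + 1) (fun p hp => by
        simp only [Set.mem_ofPred_eq, not_or, not_not] at hp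
        rw [hp.1, hp.2]
        gcongr
        exact ih _) (by
        filter_upwards [M.reward_mem s (σ s)] with p hp
        rw [add_comm]
        exact add_le_add (M.value_le _ k _) (ENNReal.ofReal_le_one.2 hp.2))
    refine h1.trans ?_
    have h2 := h.step_le s (σ s)
    calc _ ≤ ENNReal.ofReal (ρ s (σ s)) + (D + ENNReal.ofReal ε * (k : ℝ≥0∞) ^ 2) +
          (k + 1) * ENNReal.ofReal ε := by gcongr
      _ = D + ENNReal.ofReal (ρ s (σ s)) + ENNReal.ofReal ε * ((k : ℝ≥0∞) ^ 2 + k + 1) := by ring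
      _ ≤ _ := by
        gcongr
        have : (k : ℝ≥0∞) ^ 2 + k + 1 ≤ (k : ℝ≥0∞) ^ 2 + k + 1 + k := le_self_add
        refine this.trans (le_of_eq ?_)
        push_cast; ring

end NearDeterminism

/-! ### Consistent conditioning functions. -/

section Consistency

variable (M : MDP S A) (π : Kernel S A)

lemma measurableSet_totalReturn_ne (k : ℕ) (y : ℝ) :
    MeasurableSet {τ : Traj S A k | totalReturn τ ≠ y} :=
  (measurable_totalReturn k (measurableSet_singleton y)).compl

/-- The probability that the reward at `s` differs from `f s`. -/
def rewardNe (f : S → ℝ) (s : S) : ℝ≥0∞ := ∫⁻ a, M.step (s, a) {p | p.1 ≠ f s} ∂π s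

open Classical in
/-- The probability that the reward at `s` differs from `f s`, at the last timestep. -/
def lastRewardNe (f : S → ℝ) (s : S) : ℝ≥0∞ := if M.time s = M.horizon then M.rewardNe π f s else 0

variable [IsMarkovKernel π]

lemma measurable_lastRewardNe {f : S → ℝ} (hf : Measurable f) :
    Measurable (M.lastRewardNe π f) := by
  refine Measurable.ite (M.time_measurable (measurableSet_singleton _)) ?_ measurable_const
  refine Measurable.lintegral_kernel_prod_right'
    (f := fun q : S × A => M.step q {p | p.1 ≠ f q.1}) ?_
  exact Kernel.measurable_kernel_prodMk_left (κ := M.step)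
    (t := {q : (S × A) × (ℝ × S) | q.2.1 ≠ f q.1.1})
    (measurableSet_eq_fun (by fun_prop) (by fun_prop)).compl

/-- Under a consistent `f`, the return can differ from `f` only by the last reward. -/
theorem Consistent.rollout_totalReturn_ne_le {M : MDP S A} {f : S → ℝ} (hc : M.Consistent f)
    (hf : Measurable f) (k : ℕ) (s : S) (hs : M.time s + (k + 1) = M.horizon + 1) :
    M.rollout π (k + 1) s {τ | totalReturn τ ≠ f s} ≤
      M.visits π (M.lastRewardNe π f) (k + 1) s := by
  have hb := M.measurable_lastRewardNe π hf
  -- Conditioning on the first step lowers the target by the first reward.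
  have hstep : ∀ k s, M.rollout π (k + 1) s {τ | totalReturn τ ≠ f s} =
      ∫⁻ a, ∫⁻ p, M.rollout π k p.2 {τ | totalReturn τ ≠ f s - p.1} ∂M.step (s, a) ∂π s := by
    intro k s
    have hm := measurableSet_totalReturn_ne (S := S) (A := A) (k + 1) (f s)
    rw [← lintegral_indicator_one hm, M.lintegral_rollout_succ' π k (measurable_one.indicator hm)]
    refine lintegral_congr fun a => lintegral_congr fun p => ?_
    rw [← lintegral_indicator_one (measurableSet_totalReturn_ne k (f s - p.1))]
    refine lintegral_congr fun τ => ?_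
    simp only [Set.indicator, Set.mem_ofPred_eq, totalReturn, Fin.sum_univ_succ, Fin.cons_zero,
      Fin.cons_succ, ne_eq, eq_sub_iff_add_eq, add_comm, Pi.one_apply]
  induction k generalizing s with
  | zero =>
    rw [hstep, visits_succ _ _ hb]
    refine le_trans (le_of_eq ?_) le_self_add
    rw [lastRewardNe, if_pos (by omega), rewardNe]
    refine lintegral_congr fun a => ?_
    have hm : MeasurableSet {p : ℝ × S | p.1 ≠ f s} :=
      (measurableSet_eq_fun (by fun_prop) (by fun_prop)).compl
    rw [← lintegral_indicator_one hm]
    refine lintegral_congr fun p => ?_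
    have h0 := measurableSet_totalReturn_ne (S := S) (A := A) 0 (f s - p.1)
    rw [rollout, Kernel.const_apply, Measure.dirac_apply' _ h0]
    simp [Set.indicator, totalReturn, sub_eq_zero, eq_comm]
  | succ k ih =>
    rw [hstep, visits_succ _ _ hb]
    refine le_trans (lintegral_mono fun a => ?_) le_add_self
    refine lintegral_mono_ae ?_
    filter_upwards [hc s a (by omega), M.step_time s a (by omega)] with p hp hp'
    -- By consistency the lowered target is the value of `f` at the next state, so the claim
    -- reproduces itself.
    rw [hp, add_sub_cancel_right]
    exact ih _ (by omega)

end Consistency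

/-! ### The infinite-data policy attains its target returns. -/

section Rcsl

variable (M : MDP S A) (β : Kernel S A) [IsMarkovKernel β] {f : S → ℝ}

/-- Bayes' rule in multiplied form; it keeps the division by the return probability out of later
integrals. -/
lemma returnProb_mul_lintegral_rcsl (hf : Measurable f) {s : S} (hs : M.returnProb β s (f s) ≠ 0)
    {φ : A → ℝ≥0∞} (hφ : Measurable φ) :
    M.returnProb β s (f s) * ∫⁻ a, φ a ∂M.rcsl β f s =
      ∫⁻ a, φ a * M.returnProbAction β s a (f s) ∂β s := by
  classical
  have h1 := M.measurable_returnProb β hf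
  have h2 := M.measurable_returnProbAction β hf
  have hne : M.returnProb β s (f s) ≠ ⊤ := measure_ne_top _ _
  have h3 : Measurable fun a => M.returnProbAction β s a (f s) := h2.comp measurable_prodMk_left
  unfold rcsl
  rw [Kernel.lintegral_withDensity _ _ _ hφ]
  · simp only [hs, if_false]
    rw [← lintegral_const_mul _ (by fun_prop)]
    refine lintegral_congr fun a => ?_
    rw [← mul_assoc, ENNReal.mul_div_cancel hs hne, mul_comm]
  · refine Measurable.ite ?_ measurable_const (h2.div (h1.comp measurable_fst))
    exact (h1.comp measurable_fst) (measurableSet_singleton 0)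

/-- At the last timestep the return is the reward, so the integrand over `β` is `P(r ≠ f(s)) · P(r =
f(s))`, one factor of which is at most `ε`. The normalization costs `1 / α`. -/
lemma rewardNe_rcsl_le (hf : Measurable f) {T : S → A → S} {ρ : S → A → ℝ} {ε : ℝ}
    (h : M.NearlyDeterministic T ρ ε) {s : S} (hs : M.time s = M.horizon) {α : ℝ} (hα : 0 < α)
    (hαs : α ≤ (M.returnProb β s (f s)).toReal) :
    M.rewardNe (M.rcsl β f) f s ≤ ENNReal.ofReal ε / ENNReal.ofReal α := by
  have hαs' : ENNReal.ofReal α ≤ M.returnProb β s (f s) :=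
    (ENNReal.ofReal_le_iff_le_toReal (measure_ne_top _ _)).2 hαs
  have h0 : ENNReal.ofReal α ≠ 0 := by simpa using hα
  rw [ENNReal.le_div_iff_mul_le (Or.inl h0) (Or.inl ENNReal.ofReal_ne_top), mul_comm]
  have hm : MeasurableSet {p : ℝ × S | p.1 ≠ f s} :=
    (measurableSet_eq_fun (by fun_prop) (by fun_prop)).compl
  have hφ : Measurable fun a => M.step (s, a) {p | p.1 ≠ f s} :=
    (Kernel.measurable_coe M.step hm).comp measurable_prodMk_left
  calc ENNReal.ofReal α * M.rewardNe (M.rcsl β f) f s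
      ≤ M.returnProb β s (f s) * M.rewardNe (M.rcsl β f) f s := by gcongr
    _ = ∫⁻ a, M.step (s, a) {p | p.1 ≠ f s} * M.returnProbAction β s a (f s) ∂β s :=
        M.returnProb_mul_lintegral_rcsl β hf (by
          intro h'; rw [h'] at hαs'; exact h0 (le_antisymm hαs' bot_le)) hφ
    _ ≤ ∫⁻ _, ENNReal.ofReal ε ∂β s := by
        refine lintegral_mono fun a => ?_
        have hr : M.returnProbAction β s a (f s) = M.step (s, a) {p | p.1 = f s} := by
          have hm2 : MeasurableSet {x : (ℝ × S) × Traj S A 0 | x.1.1 + totalReturn x.2 = f s} :=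
            measurableSet_eq_fun
              ((by fun_prop : Measurable fun x : (ℝ × S) × Traj S A 0 => x.1.1).add
                ((measurable_totalReturn 0).comp measurable_snd)) measurable_const
          have hm3 : MeasurableSet {p : ℝ × S | p.1 = f s} :=
            measurableSet_eq_fun (by fun_prop) (by fun_prop)
          rw [returnProbAction, hs, Nat.sub_self, ← lintegral_indicator_one hm2,
            M.lintegral_stepThen _ (measurable_one.indicator hm2), ← lintegral_indicator_one hm3]
          simp [Set.indicator, totalReturn]
        rw [hr]
        -- If the target is the nominal reward, missing it is the rare event; otherwise hitting it
        -- is.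
        by_cases hfa : f s = ρ s a
        · calc _ ≤ ENNReal.ofReal ε * 1 := by
                gcongr
                · refine (measure_mono ?_).trans (h.step_le s a)
                  intro p hp; exact Or.inl (hfa ▸ hp)
                · exact prob_le_one
            _ = _ := mul_one _
        · calc _ ≤ 1 * ENNReal.ofReal ε := by
                gcongr
                · exact prob_le_one
                · refine (measure_mono ?_).trans (h.step_le s a)
                  intro p hp; exact Or.inl fun hp' => hfa (hp.symm.trans hp')
            _ = _ := one_mul _
    _ = _ := by simp

/-- The infinite-data policy nearly attains the returns it is conditioned on. -/
theorem lintegral_init_le_value_rcsl (hf : Measurable f) {T : S → A → S} {ρ : S → A → ℝ} {ε : ℝ}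
    (h : M.NearlyDeterministic T ρ ε) (hc : M.Consistent f) {α : ℝ} (hα : 0 < α)
    (hcov : M.Covers β f α) (hac : M.occ (M.rcsl β f) ≪ M.occ β)
    (hfH : ∀ᵐ s ∂M.init, f s ≤ M.horizon) :
    ∫⁻ s, ENNReal.ofReal (f s) ∂M.init ≤ ∫⁻ s, M.value (M.rcsl β f) M.horizon s ∂M.init +
      (M.horizon : ℝ≥0∞) ^ 2 * (ENNReal.ofReal ε / ENNReal.ofReal α) := by
  have := M.isMarkovKernel_rcsl β hf
  set π := M.rcsl β f
  have := M.isProbabilityMeasure_occ π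
  have hb := M.measurable_lastRewardNe π hf
  have hpos := M.horizon_pos
  have hpt : ∀ᵐ s ∂M.init, ENNReal.ofReal (f s) ≤
      M.value π M.horizon s + M.horizon * M.visits π (M.lastRewardNe π f) M.horizon s := by
    filter_upwards [hfH, M.init_time] with s hs hs1
    have hm := measurableSet_totalReturn_ne (S := S) (A := A) M.horizon (f s)
    have h1 : M.rollout π M.horizon s {τ | totalReturn τ ≠ f s} ≤
        M.visits π (M.lastRewardNe π f) M.horizon s := by
      have := hc.rollout_totalReturn_ne_le π hf (M.horizon - 1) s (by omega)
      rwa [Nat.sub_add_cancel hpos] at this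
    refine le_trans ?_ (add_le_add le_rfl (mul_le_mul le_rfl h1 bot_le bot_le))
    rw [← lintegral_indicator_const hm, value, ← lintegral_add_left (by fun_prop)]
    calc ENNReal.ofReal (f s) = ∫⁻ _, ENNReal.ofReal (f s) ∂M.rollout π M.horizon s := by simp
      _ ≤ _ := by
        refine lintegral_mono fun τ => ?_
        -- A trajectory that hits its target collects `f s`; one that misses it loses at most `H`.
        by_cases hτ : totalReturn τ = f s
        · refine le_trans ?_ le_self_add
          rw [← hτ]
          exact Finset.le_sum_of_subadditive _ ENNReal.ofReal_zero.le
            (fun _ _ => ENNReal.ofReal_add_le) _ _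
        · refine le_trans ?_ le_add_self
          rw [Set.indicator_of_mem (by exact hτ)]
          exact (ENNReal.ofReal_le_ofReal hs).trans (by simp)
  have hocc : ∫⁻ s, M.lastRewardNe π f s ∂M.occ π ≤ ENNReal.ofReal ε / ENNReal.ofReal α := by
    calc _ ≤ ∫⁻ _, ENNReal.ofReal ε / ENNReal.ofReal α ∂M.occ π := by
          refine lintegral_mono_ae ?_
          -- Coverage is known for states visited by `β`; absolute continuity carries it to those
          -- visited by `rcsl`.
          filter_upwards [hac.ae_le hcov] with s hs
          unfold lastRewardNe
          split_ifs with hH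
          · exact M.rewardNe_rcsl_le β hf h hH hα hs
          · exact bot_le
      _ = _ := by simp
  calc _ ≤ ∫⁻ s, M.value π M.horizon s +
        M.horizon * M.visits π (M.lastRewardNe π f) M.horizon s ∂M.init := lintegral_mono_ae hpt
    _ = ∫⁻ s, M.value π M.horizon s ∂M.init +
        M.horizon * (M.horizon * ∫⁻ s, M.lastRewardNe π f s ∂M.occ π) := by
        rw [lintegral_add_left (M.measurable_value π _),
          lintegral_const_mul _ (M.measurable_visits π hb _), M.lintegral_occ π hb]
    _ ≤ _ := by
        rw [pow_two, mul_assoc]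
        gcongr

end Rcsl

end MDP

/-! ### Linearized Pinsker inequality. -/

open InformationTheory in
/-- A one-sided and linearized form of Pinsker's inequality. -/
theorem lintegral_le_lintegral_add_klDiv {Ω : Type*} [MeasurableSpace Ω] (P Q : Measure Ω)
    [IsProbabilityMeasure P] [IsProbabilityMeasure Q] {φ : Ω → ℝ≥0∞} (hφ : Measurable φ)
    {B : ℝ≥0∞} (hB : ∀ x, φ x ≤ B) {l : ℝ} (hl : 0 < l) :
    ∫⁻ x, φ x ∂P ≤ ∫⁻ x, φ x ∂Q +
      B * (ENNReal.ofReal l * klDiv P Q + ENNReal.ofReal l⁻¹) := by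
  by_cases hac : P ≪ Q
  swap
  · rw [klDiv_of_not_ac hac, ENNReal.mul_top (by simpa using hl), top_add]
    rcases eq_or_ne B 0 with rfl | h0
    · have : ∀ x, φ x = 0 := fun x => le_antisymm (hB x) bot_le
      simp [this]
    · simp [ENNReal.mul_top h0]
  -- Pointwise bound for the density `x = dP/dQ`: factor `x - 1 = (√x - 1)(√x + 1)` and apply the
  -- weighted AM-GM inequality. The last term integrates to `l⁻¹` under `Q`.
  have hreal : ∀ x : ℝ, 0 ≤ x → x ≤ 1 + (l * klFun x + l⁻¹ * ((x + 1) / 2)) := by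
    intro x hx
    -- Squared Hellinger distance is below Kullback-Leibler, from `log √x ≥ 1 - 1 / √x`.
    have h1 : (√x - 1) ^ 2 ≤ klFun x := by
      rcases hx.eq_or_lt with rfl | hx'
      · simp [klFun_zero]
      · have hs : 0 < √x := Real.sqrt_pos.2 hx'
        have h2 := Real.one_sub_inv_le_log_of_pos hs
        have h3 : Real.log x = 2 * Real.log √x := by rw [Real.log_sqrt hx]; ring
        have h4 : x * (√x)⁻¹ = √x := by
          rw [← div_eq_mul_inv, Real.div_sqrt]
        have h5 := Real.sq_sqrt hx
        rw [klFun_apply, h3]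
        nlinarith [mul_le_mul_of_nonneg_left h2 hx]
    have h5 := Real.sq_sqrt hx
    have h6 : x - 1 ≤ l * (√x - 1) ^ 2 + l⁻¹ * ((√x + 1) ^ 2 / 4) := by
      have h7 := sq_nonneg (l * (√x - 1) - (√x + 1) / 2)
      have h8 : l * (√x - 1) ^ 2 + l⁻¹ * ((√x + 1) ^ 2 / 4) - (x - 1) =
          l⁻¹ * (l * (√x - 1) - (√x + 1) / 2) ^ 2 := by
        field_simp
        nlinarith
      have h9 : 0 ≤ l⁻¹ * (l * (√x - 1) - (√x + 1) / 2) ^ 2 := by positivity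
      linarith
    have h7 : (√x + 1) ^ 2 / 4 ≤ (x + 1) / 2 := by nlinarith [sq_nonneg (√x - 1)]
    have h8 := mul_le_mul_of_nonneg_left h1 hl.le
    have h9 := mul_le_mul_of_nonneg_left h7 (inv_pos.2 hl).le
    linarith
  have hmr := Measure.measurable_rnDeriv P Q
  have hmk : Measurable fun x => ENNReal.ofReal (klFun (P.rnDeriv Q x).toReal) :=
    (measurable_klFun.comp hmr.ennreal_toReal).ennreal_ofReal
  calc ∫⁻ x, φ x ∂P = ∫⁻ x, P.rnDeriv Q x * φ x ∂Q := by
        rw [lintegral_rnDeriv_mul hac hφ.aemeasurable]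
    _ ≤ ∫⁻ x, φ x + B * (ENNReal.ofReal l * ENNReal.ofReal (klFun (P.rnDeriv Q x).toReal) +
          ENNReal.ofReal l⁻¹ * ((P.rnDeriv Q x + 1) / 2)) ∂Q := by
        refine lintegral_mono_ae ?_
        filter_upwards [Measure.rnDeriv_lt_top P Q] with x hx
        have hx0 := ENNReal.toReal_nonneg (a := P.rnDeriv Q x)
        have hkl := klFun_nonneg hx0
        have h1 := ENNReal.ofReal_le_ofReal (hreal _ hx0)
        rw [ENNReal.ofReal_add zero_le_one (by positivity),
          ENNReal.ofReal_add (by positivity) (by positivity), ENNReal.ofReal_mul hl.le,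
          ENNReal.ofReal_mul (inv_pos.2 hl).le, ENNReal.ofReal_div_of_pos two_pos,
          ENNReal.ofReal_add hx0 zero_le_one, ENNReal.ofReal_toReal hx.ne, ENNReal.ofReal_one,
          ENNReal.ofReal_ofNat] at h1
        calc _ ≤ (1 + (ENNReal.ofReal l * ENNReal.ofReal (klFun (P.rnDeriv Q x).toReal) +
              ENNReal.ofReal l⁻¹ * ((P.rnDeriv Q x + 1) / 2))) * φ x := by gcongr
          _ = φ x + φ x * (ENNReal.ofReal l * ENNReal.ofReal (klFun (P.rnDeriv Q x).toReal) +
              ENNReal.ofReal l⁻¹ * ((P.rnDeriv Q x + 1) / 2)) := by ring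
          _ ≤ _ := by gcongr; exact hB x
    _ = _ := by
        have hdiv : Measurable fun x => (P.rnDeriv Q x + 1) / 2 := by fun_prop
        rw [lintegral_add_left hφ, lintegral_const_mul _ (by fun_prop),
          lintegral_add_left (by fun_prop), lintegral_const_mul _ hmk,
          lintegral_const_mul _ hdiv, klDiv_eq_lintegral_klFun_of_ac hac]
        simp only [div_eq_mul_inv]
        rw [lintegral_mul_const _ (by fun_prop), lintegral_add_left hmr,
          Measure.lintegral_rnDeriv hac]
        simp only [lintegral_const, measure_univ, mul_one, one_add_one_eq_two]
        rw [ENNReal.mul_inv_cancel (by simp) (by simp), mul_one]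

/-! ### Log-densities, loss differences and log-likelihood ratios. -/

namespace CondPolicy

variable {S : Type u} {A : Type v} [MeasurableSpace S] [MeasurableSpace A] {ν : Measure A}

lemma measurable_dens_right (π : CondPolicy S A ν) (p : S × ℝ) :
    Measurable (π.dens p.1 p.2) :=
  π.dens_measurable.comp measurable_prodMk_left

/-- The logarithm of the density, as a function of state, return and action. -/
def logDens (π : CondPolicy S A ν) (q : (S × ℝ) × A) : ℝ := Real.log (π.dens q.1.1 q.1.2 q.2)

lemma measurable_logDens (π : CondPolicy S A ν) : Measurable π.logDens :=
  Real.measurable_log.comp π.dens_measurable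

lemma integrable_dens (π : CondPolicy S A ν) (p : S × ℝ) : Integrable (π.dens p.1 p.2) ν := by
  refine ⟨(π.measurable_dens_right p).aestronglyMeasurable, ?_⟩
  rw [hasFiniteIntegral_iff_ofReal (Filter.Eventually.of_forall (π.dens_nonneg _ _)),
    π.dens_lintegral]
  exact ENNReal.one_lt_top

lemma integral_dens (π : CondPolicy S A ν) (p : S × ℝ) : ∫ a, π.dens p.1 p.2 a ∂ν = 1 := by
  rw [integral_eq_lintegral_of_nonneg_ae (Filter.Eventually.of_forall (π.dens_nonneg _ _))
    (π.measurable_dens_right p).aestronglyMeasurable, π.dens_lintegral, ENNReal.toReal_one]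

variable [SFinite ν]

lemma toKernel_apply (π : CondPolicy S A ν) (p : S × ℝ) :
    π.toKernel p = ν.withDensity fun a => ENNReal.ofReal (π.dens p.1 p.2 a) := by
  unfold toKernel
  rw [Kernel.withDensity_apply _ π.dens_measurable.ennreal_ofReal, Kernel.const_apply]

instance (π : CondPolicy S A ν) : IsMarkovKernel π.toKernel :=
  ⟨fun p => ⟨by
    rw [toKernel_apply, withDensity_apply _ MeasurableSet.univ, setLIntegral_univ]
    exact π.dens_lintegral _ _⟩⟩

instance (π : CondPolicy S A ν) (f : S → ℝ) (hf : Measurable f) : IsMarkovKernel (π.test f hf) := by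
  unfold test; infer_instance

variable {π π' : CondPolicy S A ν}

lemma toKernel_eq_tilted (h : ∀ s g a, 0 < π.dens s g a) (p : S × ℝ) :
    π.toKernel p = ν.tilted fun a => π.logDens (p, a) := by
  simp only [toKernel_apply, Measure.tilted, logDens, Real.exp_log (h _ _ _), integral_dens,
    div_one]

/-- Changing the policy changes the Kullback-Leibler divergence by an expected log-likelihood
ratio. -/
lemma klDiv_add_le (h : ∀ s g a, 0 < π.dens s g a) (h' : ∀ s g a, 0 < π'.dens s g a)
    {B : ℝ} (hB : ∀ q, |π.logDens q - π'.logDens q| ≤ B) (P : Measure A) [IsProbabilityMeasure P]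
    (p : S × ℝ) :
    InformationTheory.klDiv P (π.toKernel p) + ENNReal.ofReal B ≤
      InformationTheory.klDiv P (π'.toKernel p) +
        ENNReal.ofReal (B + ∫ a, (π'.logDens (p, a) - π.logDens (p, a)) ∂P) := by
  by_cases htop : InformationTheory.klDiv P (π'.toKernel p) = ⊤
  · simp [htop]
  obtain ⟨hac, hint⟩ := InformationTheory.klDiv_ne_top_iff.1 htop
  set g : A → ℝ := fun a => π.logDens (p, a) - π'.logDens (p, a) with hg
  have hexp : ∀ a, Real.exp (π.logDens (p, a)) = π.dens p.1 p.2 a := fun a =>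
    Real.exp_log (h _ _ _)
  have hexp' : ∀ a, Real.exp (π'.logDens (p, a)) = π'.dens p.1 p.2 a := fun a =>
    Real.exp_log (h' _ _ _)
  have hi' : Integrable (fun a => Real.exp (π'.logDens (p, a))) ν := by
    simpa only [hexp'] using π'.integrable_dens p
  -- One policy is the exponential tilt of the other by the log-ratio `g`, with normalizing constant
  -- `1`; hence the log-likelihood ratios of `P` differ exactly by `g`.
  have htilt : π.toKernel p = (π'.toKernel p).tilted g := by
    rw [toKernel_eq_tilted h, toKernel_eq_tilted h', tilted_tilted hi']
    congr 1
    ext a; simp [hg]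
  have hgm : Measurable g := (π.measurable_logDens.comp measurable_prodMk_left).sub
    (π'.measurable_logDens.comp measurable_prodMk_left)
  have hgint : ∀ μ : Measure A, IsFiniteMeasure μ → Integrable g μ := fun μ _ =>
    Integrable.of_bound hgm.aestronglyMeasurable B (Filter.Eventually.of_forall fun a => hB (p, a))
  have hei : Integrable (fun a => Real.exp (g a)) (π'.toKernel p) :=
    Integrable.of_bound (Real.measurable_exp.comp hgm).aestronglyMeasurable (Real.exp B)
      (Filter.Eventually.of_forall fun a => by
        rw [Real.norm_eq_abs, Real.abs_exp]
        exact Real.exp_le_exp.2 ((le_abs_self _).trans (hB (p, a))))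
  have hei1 : ∫ a, Real.exp (g a) ∂(π'.toKernel p) = 1 := by
    rw [toKernel_eq_tilted h', integral_exp_tilted]
    simp only [hg, Pi.add_apply, add_sub_cancel, hexp, hexp', integral_dens, div_one]
  have hac2 : P ≪ π.toKernel p := htilt ▸ hac.trans (absolutelyContinuous_tilted hei)
  have hint2 : Integrable (llr P (π.toKernel p)) P :=
    htilt ▸ integrable_llr_tilted_right hac (hgint P inferInstance) hint hei
  have hkey := integral_llr_tilted_right hac (hgint P inferInstance) hei hint
  rw [← htilt, hei1, Real.log_one, add_zero,
    ← InformationTheory.toReal_klDiv_of_measure_eq hac2 (by simp),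
    ← InformationTheory.toReal_klDiv_of_measure_eq hac (by simp)] at hkey
  have hne := InformationTheory.klDiv_ne_top hac2 hint2
  have hB0 : 0 ≤ B := by
    have : Nonempty A := P.nonempty_of_neZero
    exact (abs_nonneg _).trans (hB (p, Classical.arbitrary A))
  have hneg : ∫ a, (π'.logDens (p, a) - π.logDens (p, a)) ∂P = -∫ a, g a ∂P := by
    rw [← integral_neg]; simp [hg]
  rw [hneg, ← ENNReal.ofReal_toReal hne, ← ENNReal.ofReal_toReal htop,
    ← ENNReal.ofReal_add ENNReal.toReal_nonneg hB0]
  -- Adding `B` to both sides keeps the signed mean of the log-ratio representable in `ℝ≥0∞`.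
  refine le_trans (le_of_eq ?_) ENNReal.ofReal_add_le
  congr 1
  linarith

end CondPolicy

namespace MDP

variable {S : Type u} {A : Type v} [MeasurableSpace S] [MeasurableSpace A]

lemma isProbabilityMeasure_joint (M : MDP S A) (β : Kernel S A) [IsMarkovKernel β] :
    IsProbabilityMeasure (M.joint β) := by
  refine ⟨?_⟩
  have h := M.lintegral_joint β (φ := fun _ => 1) measurable_const
  have h0 : (M.horizon : ℝ≥0∞) ≠ 0 := by simpa using M.horizon_pos.ne'
  simp only [lintegral_const, measure_univ, Finset.sum_const, Finset.card_univ,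
    Fintype.card_fin, nsmul_eq_mul, mul_one, one_mul] at h
  exact (ENNReal.mul_right_inj h0 (ENNReal.natCast_ne_top _)).1 (by simpa using h)

variable [StandardBorelSpace A] [Nonempty A] {ν : Measure A} [SFinite ν]

instance (M : MDP S A) (β : Kernel S A) [IsMarkovKernel β] : IsMarkovKernel (M.condAction β) := by
  unfold condAction; infer_instance

lemma fst_joint_compProd_condAction (M : MDP S A) (β : Kernel S A) [IsMarkovKernel β] :
    (M.joint β).fst ⊗ₘ M.condAction β = M.joint β := by
  unfold condAction
  exact (M.joint β).disintegrate _

/-- The excess loss is the expected log-likelihood ratio. -/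
theorem loss_add_le (M : MDP S A) (β : Kernel S A) [IsMarkovKernel β] {π π' : CondPolicy S A ν}
    (h : ∀ s g a, 0 < π.dens s g a) (h' : ∀ s g a, 0 < π'.dens s g a)
    {B : ℝ} (hB : ∀ q, |π.logDens q - π'.logDens q| ≤ B) :
    M.loss β π + ENNReal.ofReal B ≤
      M.loss β π' + ENNReal.ofReal (B + ∫ q, (π'.logDens q - π.logDens q) ∂M.joint β) := by
  have := M.isProbabilityMeasure_joint β
  have hm : Measurable fun q => π'.logDens q - π.logDens q :=
    π'.measurable_logDens.sub π.measurable_logDens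
  have hB' : ∀ q, ‖π'.logDens q - π.logDens q‖ ≤ B := fun q => by
    rw [Real.norm_eq_abs, abs_sub_comm]; exact hB q
  have hint : Integrable (fun q => π'.logDens q - π.logDens q) (M.joint β) :=
    Integrable.of_bound hm.aestronglyMeasurable B (Filter.Eventually.of_forall hB')
  set D : S × ℝ → ℝ := fun p => ∫ a, (π'.logDens (p, a) - π.logDens (p, a)) ∂M.condAction β p
    with hD
  have hDm : Measurable D :=
    (hm.stronglyMeasurable.integral_kernel_prod_right' (κ := M.condAction β)).measurable
  have hDB : ∀ p, ‖D p‖ ≤ B := fun p => by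
    have := norm_integral_le_of_norm_le_const (μ := M.condAction β p)
      (Filter.Eventually.of_forall fun a => hB' (p, a))
    simpa [hD] using this
  have hDint : Integrable D (M.joint β).fst :=
    Integrable.of_bound hDm.aestronglyMeasurable B (Filter.Eventually.of_forall hDB)
  have hDeq : ∫ p, D p ∂(M.joint β).fst = ∫ q, (π'.logDens q - π.logDens q) ∂M.joint β := by
    rw [← M.fst_joint_compProd_condAction β] at hint
    conv_rhs => rw [← M.fst_joint_compProd_condAction β]
    rw [Measure.integral_compProd hint]
  unfold loss
  calc _ = ∫⁻ p, (InformationTheory.klDiv (M.condAction β p) (π.toKernel p) + ENNReal.ofReal B)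
        ∂(M.joint β).fst := by
        rw [lintegral_add_right _ measurable_const]; simp
    _ ≤ ∫⁻ p, (InformationTheory.klDiv (M.condAction β p) (π'.toKernel p) +
        ENNReal.ofReal (B + D p)) ∂(M.joint β).fst :=
        lintegral_mono fun p => CondPolicy.klDiv_add_le h h' hB _ p
    _ = _ := by
        have hi : Integrable (fun p => B + D p) (M.joint β).fst := (integrable_const _).add hDint
        rw [lintegral_add_right _ (by fun_prop), ← ofReal_integral_eq_lintegral_ofReal hi (Filter.Eventually.of_forall fun p => by
            have := neg_le_of_abs_le (hDB p)
            simp only [Pi.zero_apply]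
            linarith),
          integral_add (integrable_const _) hDint, hDeq]
        simp

end MDP

/-! ### Concentration and empirical risk minimization. -/

/-- A sample mean of bounded variables is unlikely to be nonnegative when the mean is negative. -/
theorem measureReal_pi_sum_nonneg_le {Ω : Type*} [MeasurableSpace Ω] (μ : Measure Ω)
    [IsProbabilityMeasure μ] {X : Ω → ℝ} (hX : Measurable X) {a w : ℝ} (hw : 0 ≤ w)
    (hXw : ∀ x, X x ∈ Set.Icc a (a + w)) {N : ℕ} (hN : 0 < N) {u L : ℝ} (hu : 0 ≤ u)
    (hL : w ^ 2 * L ≤ 2 * N * u ^ 2) (hXu : μ[X] < -u) :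
    (Measure.pi fun _ : Fin N => μ).real {D | 0 ≤ ∑ i, X (D i)} ≤ Real.exp (-L) := by
  have hN' : (0 : ℝ) < N := by exact_mod_cast hN
  -- For `w = 0` the Hoeffding exponent would divide by zero; the variable is then a negative
  -- constant and the event is empty.
  rcases hw.eq_or_lt with rfl | hw
  · have hXa : ∀ x, X x = a := fun x => by
      have := hXw x
      simp only [add_zero, Set.Icc_self, Set.mem_singleton_iff] at this
      exact this
    simp only [hXa, integral_const, probReal_univ, one_smul] at hXu
    have : {D : Fin N → Ω | 0 ≤ ∑ i, X (D i)} = ∅ := by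
      ext D
      simp only [hXa, Finset.sum_const, Finset.card_univ, Fintype.card_fin, nsmul_eq_mul,
        Set.mem_ofPred_eq, Set.mem_empty_iff_false, iff_false, not_le]
      nlinarith
    rw [this, measureReal_empty]
    exact (Real.exp_pos _).le
  have hsub := hasSubgaussianMGF_of_mem_Icc (μ := μ) hX.aemeasurable
    (Filter.Eventually.of_forall hXw)
  have hYm : Measurable fun x => X x - μ[X] := hX.sub_const _
  have hind : iIndepFun (fun (i : Fin N) (D : Fin N → Ω) => X (D i) - μ[X])
      (Measure.pi fun _ : Fin N => μ) :=
    iIndepFun_pi (X := fun _ x => X x - μ[X]) fun _ => hYm.aemeasurable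
  have hsub' : ∀ i ∈ Finset.univ, HasSubgaussianMGF
      (fun D : Fin N → Ω => X (D i) - μ[X]) ((‖a + w - a‖₊ / 2) ^ 2)
      (Measure.pi fun _ : Fin N => μ) := fun i _ => by
    refine HasSubgaussianMGF.of_map (Y := fun D : Fin N → Ω => D i)
      (X := fun x => X x - μ[X])
      (μ := Measure.pi fun _ : Fin N => μ) (measurable_pi_apply i).aemeasurable ?_
    rwa [(measurePreserving_eval (fun _ : Fin N => μ) i).map_eq]
  have h := HasSubgaussianMGF.measure_sum_ge_le_of_iIndepFun hind hsub'
    (ε := N * u) (by positivity)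
  calc _ ≤ (Measure.pi fun _ : Fin N => μ).real {D | N * u ≤ ∑ i, (X (D i) - μ[X])} := by
        refine measureReal_mono fun D hD => ?_
        simp only [Set.mem_ofPred_eq] at hD ⊢
        rw [Finset.sum_sub_distrib]
        simp only [Finset.sum_const, Finset.card_univ, Fintype.card_fin, nsmul_eq_mul]
        nlinarith
    _ ≤ _ := h
    _ ≤ _ := by
        refine Real.exp_le_exp.2 ?_
        simp only [Finset.sum_const, Finset.card_univ, Fintype.card_fin, nsmul_eq_mul,
          NNReal.coe_mul, NNReal.coe_pow, NNReal.coe_div, coe_nnnorm, NNReal.coe_natCast,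
          NNReal.coe_ofNat, add_sub_cancel_left, Real.norm_eq_abs, abs_of_pos hw]
        rw [neg_div, neg_le_neg_iff, le_div_iff₀ (by positivity)]
        nlinarith

namespace CondPolicy

variable {S : Type u} {A : Type v} [MeasurableSpace S] [MeasurableSpace A] {ν : Measure A}

lemma LogBounded.abs_logDens_sub_le {π : CondPolicy S A ν} {c : ℝ} (h : π.LogBounded c)
    (q q' : (S × ℝ) × A) : |π.logDens q - π.logDens q'| ≤ c := h.2 _ _ _ _ _ _

/-- The log-likelihood ratio of a trajectory. -/
def logRatio (π π' : CondPolicy S A ν) {k : ℕ} (τ : Traj S A k) : ℝ :=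
  ∑ t, (π.logDens (((τ t).1, returnToGo τ t), (τ t).2.1) -
    π'.logDens (((τ t).1, returnToGo τ t), (τ t).2.1))

variable (π π' : CondPolicy S A ν)

lemma measurable_state_returnToGo_action {k : ℕ} (t : Fin k) :
    Measurable fun τ : Traj S A k => (((τ t).1, returnToGo τ t), (τ t).2.1) := by
  unfold returnToGo; fun_prop

lemma measurable_logRatio (k : ℕ) : Measurable (π.logRatio π' (k := k)) :=
  Finset.measurable_sum _ fun t _ =>
    (π.measurable_logDens.comp (measurable_state_returnToGo_action t)).sub
      (π'.measurable_logDens.comp (measurable_state_returnToGo_action t))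

variable {π π'}

lemma _root_.IsERM.sum_logRatio_nonneg {C : Finset (CondPolicy S A ν)} {N k : ℕ}
    {D : Fin N → Traj S A k} (h : IsERM C D π) (h' : π' ∈ C) :
    0 ≤ ∑ i, π.logRatio π' (D i) := by
  have := h.2 π' h'
  simp only [empiricalLoss, neg_le_neg_iff] at this
  simp only [logRatio, Finset.sum_sub_distrib, sub_nonneg]
  exact this

end CondPolicy

namespace MDP

variable {S : Type u} {A : Type v} [MeasurableSpace S] [MeasurableSpace A] {ν : Measure A}

lemma integral_logRatio (M : MDP S A) (β : Kernel S A) [IsMarkovKernel β]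
    (π π' : CondPolicy S A ν) {B : ℝ} (hB : ∀ q, |π.logDens q - π'.logDens q| ≤ B) :
    ∫ τ, π.logRatio π' τ ∂M.traj β =
      M.horizon * ∫ q, (π.logDens q - π'.logDens q) ∂M.joint β := by
  have hm : Measurable fun q => π.logDens q - π'.logDens q :=
    π.measurable_logDens.sub π'.measurable_logDens
  have hint : ∀ μ : Measure ((S × ℝ) × A), IsFiniteMeasure μ →
      Integrable (fun q => π.logDens q - π'.logDens q) μ := fun μ _ =>
    Integrable.of_bound hm.aestronglyMeasurable B (Filter.Eventually.of_forall hB)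
  have h0 : (M.horizon : ℝ) ≠ 0 := by exact_mod_cast M.horizon_pos.ne'
  unfold joint CondPolicy.logRatio
  rw [integral_smul_measure, integral_finsetSum_measure fun t _ => hint _ inferInstance]
  simp only [ENNReal.toReal_inv, ENNReal.toReal_natCast, smul_eq_mul]
  rw [mul_inv_cancel_left₀ h0, integral_finsetSum]
  · refine Finset.sum_congr rfl fun t _ => ?_
    rw [integral_map (CondPolicy.measurable_state_returnToGo_action t).aemeasurable
      hm.aestronglyMeasurable]
  · intro t _
    exact Integrable.of_bound
      (hm.comp (CondPolicy.measurable_state_returnToGo_action t)).aestronglyMeasurable B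
      (Filter.Eventually.of_forall fun τ => hB _)

/-- With high probability, the empirical risk minimizers have small excess log-loss. -/
theorem one_sub_le_measureReal_isERM (M : MDP S A) (β : Kernel S A) [IsMarkovKernel β]
    {C : Finset (CondPolicy S A ν)} {c : ℝ} (hc0 : 0 ≤ c) (hc : ∀ π ∈ C, π.LogBounded c)
    {π₀ : CondPolicy S A ν} (h₀ : π₀ ∈ C) (q₀ : (S × ℝ) × A)
    {N : ℕ} (hN : 0 < N) {δ : ℝ} (hδ : 0 < δ) {r : ℝ} (hr : 0 ≤ r)
    (hcr : 8 * c ^ 2 * Real.log (C.card / δ) ≤ N * r ^ 2) :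
    1 - δ ≤ (Measure.pi fun _ : Fin N => M.traj β).real
      {D | ∀ π, IsERM C D π → ∫ q, (π₀.logDens q - π.logDens q) ∂M.joint β ≤ r} := by
  classical
  set μ := Measure.pi fun _ : Fin N => M.traj β
  set B := fun π : CondPolicy S A ν =>
    {D : Fin N → Traj S A M.horizon | 0 ≤ ∑ i, π.logRatio π₀ (D i)}
  set bad := C.filter fun π => r < ∫ q, (π₀.logDens q - π.logDens q) ∂M.joint β
  have hH : (0 : ℝ) < M.horizon := by exact_mod_cast M.horizon_pos
  have hcard : (0 : ℝ) < C.card := by exact_mod_cast Finset.card_pos.2 ⟨π₀, h₀⟩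
  have hBm : ∀ π, MeasurableSet (B π) := fun π => measurableSet_le measurable_const
    (Finset.measurable_sum _ fun i _ => (π.measurable_logRatio π₀ _).comp (measurable_pi_apply i))
  have hB : ∀ π ∈ bad, μ.real (B π) ≤ δ / C.card := by
    intro π hπ
    obtain ⟨hπC, hπr⟩ := Finset.mem_filter.1 hπ
    -- The hypothesis bounds oscillations of log-densities, not their size, so the log-ratio is only
    -- confined to an interval of length `4 c` around its value at a reference point.
    set κ := π.logDens q₀ - π₀.logDens q₀
    have hκ : ∀ q, |π.logDens q - π₀.logDens q - κ| ≤ 2 * c := fun q => by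
      have h1 := (hc π hπC).abs_logDens_sub_le q q₀
      have h2 := (hc π₀ h₀).abs_logDens_sub_le q q₀
      calc _ = |(π.logDens q - π.logDens q₀) - (π₀.logDens q - π₀.logDens q₀)| := by
            congr 1; ring
        _ ≤ _ := (abs_sub _ _).trans (by linarith)
    have hmem : ∀ τ : Traj S A M.horizon, π.logRatio π₀ τ ∈
        Set.Icc (M.horizon * (κ - 2 * c)) (M.horizon * (κ - 2 * c) + 4 * M.horizon * c) := by
      intro τ
      have hl : ∑ _t : Fin M.horizon, (κ - 2 * c) ≤ π.logRatio π₀ τ :=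
        Finset.sum_le_sum fun t _ => by linarith [(abs_le.1 (hκ (((τ t).1, returnToGo τ t), (τ t).2.1))).1]
      have hu : π.logRatio π₀ τ ≤ ∑ _t : Fin M.horizon, (κ + 2 * c) :=
        Finset.sum_le_sum fun t _ => by linarith [(abs_le.1 (hκ (((τ t).1, returnToGo τ t), (τ t).2.1))).2]
      simp only [Finset.sum_const, Finset.card_univ, Fintype.card_fin, nsmul_eq_mul] at hl hu
      exact ⟨hl, by linarith⟩
    have hmean : ∫ τ, π.logRatio π₀ τ ∂M.traj β < -(M.horizon * r) := by
      rw [M.integral_logRatio β π π₀ (B := |κ| + 2 * c) fun q => by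
        have h1 := abs_add_le (π.logDens q - π₀.logDens q - κ) κ
        rw [sub_add_cancel] at h1
        linarith [hκ q]]
      have : ∫ q, (π.logDens q - π₀.logDens q) ∂M.joint β =
          -∫ q, (π₀.logDens q - π.logDens q) ∂M.joint β := by
        rw [← integral_neg]; simp
      rw [this]
      nlinarith
    -- Range `4 H c` and mean below `-H r` both scale with `H`, so the horizon cancels and the
    -- requirement is `8 c² L ≤ N r²`.
    have hexp := measureReal_pi_sum_nonneg_le (M.traj β) (π.measurable_logRatio π₀ _)
      (w := 4 * M.horizon * c) (by positivity) hmem hN (u := M.horizon * r)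
      (L := Real.log (C.card / δ)) (by positivity) (by
        have := mul_le_mul_of_nonneg_left hcr (by positivity : 0 ≤ 2 * (M.horizon : ℝ) ^ 2)
        nlinarith) hmean
    rwa [Real.exp_neg, Real.exp_log (by positivity), inv_div] at hexp
  have hunion : μ.real (⋃ π ∈ bad, B π) ≤ δ := by
    calc _ ≤ ∑ π ∈ bad, μ.real (B π) := measureReal_biUnion_finset_le _ _
      _ ≤ ∑ _π ∈ bad, δ / C.card := Finset.sum_le_sum hB
      _ ≤ ∑ _π ∈ C, δ / C.card :=
          Finset.sum_le_sum_of_subset_of_nonneg (Finset.filter_subset _ _)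
            fun _ _ _ => by positivity
      _ = δ := by
          rw [Finset.sum_const, nsmul_eq_mul]; field_simp
  calc 1 - δ ≤ 1 - μ.real (⋃ π ∈ bad, B π) := by linarith
    _ = μ.real (⋃ π ∈ bad, B π)ᶜ :=
        (probReal_compl_eq_one_sub (Finset.measurableSet_biUnion _ fun π _ => hBm π)).symm
    _ ≤ _ := by
        refine measureReal_mono fun D hD π hπ => ?_
        by_contra! hlt
        exact hD (Set.mem_biUnion (show π ∈ (bad : Set (CondPolicy S A ν)) from
          Finset.mem_coe.2 (Finset.mem_filter.2 ⟨hπ.1, hlt⟩)) (hπ.sum_logRatio_nonneg h₀))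

/-! ### From the loss to the gap between `rcsl` and the learned policy. -/

variable [StandardBorelSpace A] [Nonempty A] [SFinite ν]

/-- The gap between the infinite-data policy and a learned policy, on average over the states
visited by the behavior policy, is controlled by the loss. -/
theorem mul_lintegral_occ_sub_le (M : MDP S A) (β : Kernel S A) [IsMarkovKernel β]
    {f : S → ℝ} (hf : Measurable f) {α : ℝ} (hα : 0 < α) (hcov : M.Covers β f α)
    (π : CondPolicy S A ν) {φ : S × A → ℝ≥0∞} (hφ : Measurable φ) {B : ℝ≥0∞} (hBtop : B ≠ ⊤)
    (hB : ∀ q, φ q ≤ B) {l : ℝ} (hl : 0 < l) :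
    ENNReal.ofReal α * ∫⁻ s, (∫⁻ a, φ (s, a) ∂M.rcsl β f s - ∫⁻ a, φ (s, a) ∂π.test f hf s)
        ∂M.occ β ≤
      B * (ENNReal.ofReal l * M.loss β π + ENNReal.ofReal l⁻¹) := by
  classical
  have := M.isMarkovKernel_rcsl β hf
  have := M.isProbabilityMeasure_joint β
  set X : S → ℝ≥0∞ := fun s => ∫⁻ a, φ (s, a) ∂M.rcsl β f s with hX
  set Y : S → ℝ≥0∞ := fun s => ∫⁻ a, φ (s, a) ∂π.test f hf s with hY
  set rp : S → ℝ≥0∞ := fun s => M.returnProb β s (f s) with hrp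
  have hXm : Measurable X := Measurable.lintegral_kernel_prod_right' hφ
  have hYm : Measurable Y := Measurable.lintegral_kernel_prod_right' hφ
  have hrpm : Measurable rp := M.measurable_returnProb β hf
  have hrpam := M.measurable_returnProbAction β hf
  -- Selecting the states with a nonnegative gap turns the positive part into a difference of two
  -- linear integrals.
  set e : S → ℝ≥0∞ := {s | Y s ≤ X s}.indicator 1 with he
  have hem : Measurable e := measurable_one.indicator (measurableSet_le hYm hXm)
  have he1 : ∀ s, e s ≤ 1 := fun s => Set.indicator_le_self' (by simp) s
  have hrp0 : ∀ᵐ s ∂M.occ β, ENNReal.ofReal α ≤ rp s := by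
    filter_upwards [hcov] with s hs
    exact (ENNReal.ofReal_le_iff_le_toReal (measure_ne_top _ _)).2 hs
  have hα0 : ENNReal.ofReal α ≠ 0 := by simpa using hα
  have hYB : ∀ s, Y s ≤ B := fun s => by
    calc Y s ≤ ∫⁻ _, B ∂π.test f hf s := lintegral_mono fun a => hB _
      _ = B := by simp
  set G : Set ((S × ℝ) × A) := {q | q.1.2 = f q.1.1} with hG
  have hGm : MeasurableSet G := measurableSet_eq_fun (by fun_prop) (by fun_prop)
  have hG'm : MeasurableSet {p : S × ℝ | p.2 = f p.1} :=
    measurableSet_eq_fun (by fun_prop) (by fun_prop)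
  set w : S × ℝ → ℝ≥0∞ := fun p => {p : S × ℝ | p.2 = f p.1}.indicator 1 p * e p.1 with hw
  have hwm : Measurable w := (measurable_one.indicator hG'm).mul (hem.comp measurable_fst)
  have hw1 : ∀ p, w p ≤ 1 := fun p =>
    mul_le_one' (Set.indicator_le_self' (by simp) p) (he1 _)
  -- Weighting by the return probability given the action equals restricting the joint law to `g =
  -- f(s)`, which is then disintegrated over `(s, g)`.
  have hjoint : ∀ ψ : S × A → ℝ≥0∞, Measurable ψ →
      ∫⁻ s, ∫⁻ a, e s * ψ (s, a) * M.returnProbAction β s a (f s) ∂β s ∂M.occ β =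
        ∫⁻ p, w p * ∫⁻ a, ψ (p.1, a) ∂M.condAction β p ∂(M.joint β).fst := by
    intro ψ hψ
    have hwψ : Measurable fun q : (S × ℝ) × A => w q.1 * ψ (q.1.1, q.2) := by fun_prop
    rw [← M.lintegral_joint_indicator β hf (ψ := fun q => e q.1 * ψ q) (by fun_prop),
      ← lintegral_indicator hGm]
    calc _ = ∫⁻ q, w q.1 * ψ (q.1.1, q.2) ∂M.joint β := by
          refine lintegral_congr fun q => ?_
          by_cases hq : q.1.2 = f q.1.1 <;> simp [hw, hG, hq]
      _ = ∫⁻ q, w q.1 * ψ (q.1.1, q.2) ∂((M.joint β).fst ⊗ₘ M.condAction β) := by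
          rw [M.fst_joint_compProd_condAction β]
      _ = _ := by
          rw [Measure.lintegral_compProd hwψ]
          refine lintegral_congr fun p => ?_
          exact lintegral_const_mul (μ := M.condAction β p) (f := fun a => ψ (p.1, a)) (w p)
            (by fun_prop)
  have hI1 : ∫⁻ s, e s * rp s * X s ∂M.occ β =
      ∫⁻ p, w p * ∫⁻ a, φ (p.1, a) ∂M.condAction β p ∂(M.joint β).fst := by
    rw [← hjoint φ hφ]
    refine lintegral_congr_ae ?_
    filter_upwards [hrp0] with s hs
    have h0 : M.returnProb β s (f s) ≠ 0 := fun h' => hα0 (le_antisymm (h' ▸ hs) bot_le)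
    have h1 := M.returnProb_mul_lintegral_rcsl β hf h0
      (hφ.comp (measurable_prodMk_left (x := s)))
    simp only [hrp, hX, mul_assoc]
    simp only [Function.comp_def] at h1
    rw [h1, lintegral_const_mul]
    exact (hφ.comp measurable_prodMk_left).mul (hrpam.comp measurable_prodMk_left)
  have hI2 : ∫⁻ s, e s * rp s * Y s ∂M.occ β = ∫⁻ p, w p * Y p.1 ∂(M.joint β).fst := by
    have h1 := hjoint (fun q => Y q.1) (by fun_prop)
    simp only [lintegral_const, measure_univ, mul_one] at h1
    rw [← h1]
    refine lintegral_congr fun s => ?_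
    have h2 : Measurable fun a => M.returnProbAction β s a (f s) :=
      hrpam.comp measurable_prodMk_left
    rw [lintegral_const_mul _ h2, M.lintegral_returnProbAction]
    simp only [hrp]
    ring
  -- Finiteness allows this term to be cancelled at the end.
  have hI2top : ∫⁻ p, w p * Y p.1 ∂(M.joint β).fst ≠ ⊤ := by
    refine ne_top_of_le_ne_top hBtop ?_
    calc _ ≤ ∫⁻ _, B ∂(M.joint β).fst :=
          lintegral_mono fun p => (mul_le_mul' (hw1 p) (hYB _)).trans_eq (one_mul _)
      _ = B := by simp
  have hle : ∫⁻ s, e s * rp s * X s ∂M.occ β ≤ ∫⁻ s, e s * rp s * Y s ∂M.occ β +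
      B * (ENNReal.ofReal l * M.loss β π + ENNReal.ofReal l⁻¹) := by
    rw [hI1, hI2]
    calc _ ≤ ∫⁻ p, (w p * Y p.1 + B * (ENNReal.ofReal l * InformationTheory.klDiv
            (M.condAction β p) (π.toKernel p) + ENNReal.ofReal l⁻¹)) ∂(M.joint β).fst := by
          refine lintegral_mono fun p => ?_
          by_cases hp : p.2 = f p.1
          · have h1 := lintegral_le_lintegral_add_klDiv (M.condAction β p) (π.toKernel p)
              (hφ.comp (measurable_prodMk_left (x := p.1))) (fun a => hB (p.1, a)) hl
            have h2 : ∫⁻ a, φ (p.1, a) ∂π.toKernel p = Y p.1 := by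
              simp only [hY, CondPolicy.test, Kernel.comap_apply, ← hp]
            simp only [Function.comp_def, h2] at h1
            calc _ ≤ w p * (Y p.1 + B * (ENNReal.ofReal l * InformationTheory.klDiv
                    (M.condAction β p) (π.toKernel p) + ENNReal.ofReal l⁻¹)) := by gcongr
              _ ≤ _ := by
                  rw [mul_add]
                  exact add_le_add le_rfl (mul_le_of_le_one_left' (hw1 p))
          · have : w p = 0 := by simp [hw, hp]
            simp [this]
      _ = _ := by
          rw [lintegral_add_left (by fun_prop), lintegral_const_mul' _ _ hBtop,
            lintegral_add_right _ measurable_const, lintegral_const_mul' _ _ ENNReal.ofReal_ne_top]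
          simp [loss]
  have hsplit : ∫⁻ s, e s * rp s * X s ∂M.occ β =
      ∫⁻ s, e s * rp s * Y s ∂M.occ β + ∫⁻ s, rp s * (X s - Y s) ∂M.occ β := by
    rw [← lintegral_add_left (by fun_prop)]
    refine lintegral_congr fun s => ?_
    by_cases hs : Y s ≤ X s
    · have : e s = 1 := by simp [he, hs]
      rw [this, one_mul, ← mul_add, add_tsub_cancel_of_le hs]
    · have : e s = 0 := by simp [he, hs]
      simp [this, tsub_eq_zero_of_le (not_le.1 hs).le]
  rw [hsplit] at hle
  rw [hI2] at hle
  calc ENNReal.ofReal α * ∫⁻ s, (X s - Y s) ∂M.occ β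
      ≤ ∫⁻ s, rp s * (X s - Y s) ∂M.occ β := by
        rw [← lintegral_const_mul _ (by fun_prop)]
        refine lintegral_mono_ae ?_
        filter_upwards [hrp0] with s hs
        gcongr
    _ ≤ _ := (ENNReal.add_le_add_iff_left hI2top).1 hle

end MDP

/-! ### Expected returns and assembly of the two gaps. -/

namespace MDP

variable {S : Type u} {A : Type v} [MeasurableSpace S] [MeasurableSpace A]

lemma ae_rollout_reward_nonneg (M : MDP S A) (π : Kernel S A) [IsMarkovKernel π] (k : ℕ) (s : S) :
    ∀ᵐ τ ∂M.rollout π k s, ∀ j, 0 ≤ (τ j).2.2 := by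
  have hm : MeasurableSet {x : S × A × ℝ | x.2.2 < 0} :=
    measurableSet_lt (by fun_prop) measurable_const
  set g : S × A × ℝ → ℝ≥0∞ := {x | x.2.2 < 0}.indicator 1 with hg
  have hgm : Measurable g := measurable_one.indicator hm
  have h : ∫⁻ τ, ∑ j, g (τ j) ∂M.rollout π k s = 0 := by
    induction k generalizing s with
    | zero => simp
    | succ k ih =>
      rw [M.lintegral_rollout_succ' π k (by fun_prop)]
      have h1 : ∀ a, ∫⁻ p, ∫⁻ τ, ∑ j, g ((Fin.cons (s, a, p.1) τ : Traj S A (k + 1)) j)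
          ∂M.rollout π k p.2 ∂M.step (s, a) = 0 := by
        intro a
        rw [← lintegral_zero (μ := M.step (s, a))]
        refine lintegral_congr_ae ?_
        filter_upwards [M.reward_mem s a] with p hp
        have : g (s, a, p.1) = 0 := by simp [hg, hp.1]
        simp only [Fin.sum_univ_succ, Fin.cons_zero, Fin.cons_succ, this, zero_add]
        exact ih _
      simp [h1]
  rw [lintegral_eq_zero_iff (by fun_prop)] at h
  filter_upwards [h] with τ hτ j
  by_contra! hlt
  have h1 := (Finset.sum_eq_zero_iff.1 hτ) j (Finset.mem_univ j)
  simp [hg, hlt] at h1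

lemma lintegral_value_le (M : MDP S A) (π : Kernel S A) [IsMarkovKernel π] :
    ∫⁻ s, M.value π M.horizon s ∂M.init ≤ M.horizon :=
  (lintegral_mono fun s => M.value_le π _ s).trans_eq (by simp)

/-- The expected return as a lower integral. -/
lemma J_eq_toReal (M : MDP S A) (π : Kernel S A) [IsMarkovKernel π] :
    M.J π = (∫⁻ s, M.value π M.horizon s ∂M.init).toReal := by
  have hae : ∀ᵐ τ ∂M.traj π, ∀ j, 0 ≤ (τ j).2.2 := by
    unfold traj
    refine Measure.ae_comp_of_ae_ae ?_ (Filter.Eventually.of_forall fun s =>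
      M.ae_rollout_reward_nonneg π _ s)
    rw [Set.ofPred_forall]
    exact MeasurableSet.iInter fun j => measurableSet_le measurable_const (by fun_prop)
  unfold J
  rw [integral_eq_lintegral_of_nonneg_ae (by
    filter_upwards [hae] with τ hτ using Finset.sum_nonneg fun j _ => hτ j)
    (measurable_totalReturn _).aestronglyMeasurable]
  congr 1
  calc _ = ∫⁻ τ, ∑ j, ENNReal.ofReal (τ j).2.2 ∂M.traj π := by
        refine lintegral_congr_ae ?_
        filter_upwards [hae] with τ hτ
        rw [totalReturn, ENNReal.ofReal_sum_of_nonneg fun j _ => hτ j]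
    _ = _ := by
        unfold traj value
        rw [Measure.lintegral_bind (Kernel.aemeasurable _)
          (by fun_prop : Measurable fun τ : Traj S A M.horizon =>
            ∑ j, ENNReal.ofReal (τ j).2.2).aemeasurable]

lemma J_nonneg (M : MDP S A) (π : Kernel S A) [IsMarkovKernel π] : 0 ≤ M.J π := by
  rw [J_eq_toReal]; exact ENNReal.toReal_nonneg

lemma J_le_horizon (M : MDP S A) (π : Kernel S A) [IsMarkovKernel π] : M.J π ≤ M.horizon := by
  rw [J_eq_toReal]
  exact ENNReal.toReal_le_of_le_ofReal (Nat.cast_nonneg _)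
    (by simpa using M.lintegral_value_le π)

/-- A bound on the values at the first step bounds the expected returns. -/
lemma J_sub_le (M : MDP S A) (π π' : Kernel S A) [IsMarkovKernel π] [IsMarkovKernel π'] {x : ℝ}
    (hx : 0 ≤ x) (h : ∫⁻ s, M.value π M.horizon s ∂M.init ≤
      ∫⁻ s, M.value π' M.horizon s ∂M.init + ENNReal.ofReal x) : M.J π - M.J π' ≤ x := by
  have h' : ∫⁻ s, M.value π' M.horizon s ∂M.init ≠ ⊤ :=
    ne_top_of_le_ne_top (ENNReal.natCast_ne_top _) (M.lintegral_value_le π')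
  have h1 := ENNReal.toReal_mono (ENNReal.add_ne_top.2 ⟨h', ENNReal.ofReal_ne_top⟩) h
  rw [ENNReal.toReal_add h' ENNReal.ofReal_ne_top, ENNReal.toReal_ofReal hx] at h1
  rw [J_eq_toReal, J_eq_toReal]
  linarith

/-- The deterministic optimal policy is nearly matched by the infinite-data policy. -/
theorem lintegral_value_le_rcsl (M : MDP S A) (β : Kernel S A) [IsMarkovKernel β]
    {σ : S → A} (hσ : Measurable σ) {T : S → A → S} {ρ : S → A → ℝ} {ε : ℝ}
    (hdet : M.NearlyDeterministic T ρ ε) (hε0 : 0 ≤ ε) (hε : ε < 1) {f : S → ℝ}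
    (hf : Measurable f) (hfσ : ∀ᵐ s ∂M.init, f s = M.detReturn T ρ σ s) (hcons : M.Consistent f)
    {α : ℝ} (hα : 0 < α) (hcov : M.Covers β f α) (hac : M.occ (M.rcsl β f) ≪ M.occ β) :
    ∫⁻ s, M.value (Kernel.deterministic σ hσ) M.horizon s ∂M.init ≤
      ∫⁻ s, M.value (M.rcsl β f) M.horizon s ∂M.init +
        ENNReal.ofReal ((M.horizon : ℝ) ^ 2 * (ε / α + ε)) := by
  have h1 : ∫⁻ s, M.value (Kernel.deterministic σ hσ) M.horizon s ∂M.init ≤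
      ∫⁻ s, ENNReal.ofReal (f s) ∂M.init + ENNReal.ofReal ε * (M.horizon : ℝ≥0∞) ^ 2 := by
    calc _ ≤ ∫⁻ s, ENNReal.ofReal (f s) + ENNReal.ofReal ε * (M.horizon : ℝ≥0∞) ^ 2 ∂M.init := by
          refine lintegral_mono_ae ?_
          filter_upwards [hfσ] with s hs
          rw [hs]
          exact hdet.value_deterministic_le hε hσ _ s
      _ = _ := by rw [lintegral_add_right _ measurable_const]; simp
  have hfH : ∀ᵐ s ∂M.init, f s ≤ M.horizon := by
    filter_upwards [hfσ] with s hs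
    rw [hs, detReturn]
    refine (Finset.sum_le_card_nsmul _ _ 1 fun t _ => (hdet.mem_Icc hε _ _).2).trans ?_
    simp
  have h2 := M.lintegral_init_le_value_rcsl β hf hdet hcons hα hcov hac hfH
  refine h1.trans ((add_le_add h2 le_rfl).trans (le_of_eq ?_))
  rw [add_assoc, ENNReal.ofReal_mul (by positivity), ENNReal.ofReal_add (by positivity) hε0,
    ENNReal.ofReal_div_of_pos hα, ENNReal.ofReal_pow (by positivity), ENNReal.ofReal_natCast]
  ring

variable [StandardBorelSpace A] [Nonempty A] {ν : Measure A} [SFinite ν]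

/-- The learned policy nearly matches the infinite-data policy when its loss is small. -/
theorem lintegral_value_rcsl_le (M : MDP S A) (β : Kernel S A) [IsMarkovKernel β] {f : S → ℝ}
    (hf : Measurable f) {α : ℝ} (hα : 0 < α) (hcov : M.Covers β f α) {Cf : ℝ} (hCf : 0 ≤ Cf)
    (hocc : M.occ (M.rcsl β f) ≤ ENNReal.ofReal Cf • M.occ β) (π : CondPolicy S A ν) {ℓ : ℝ}
    (hℓ : 0 ≤ ℓ) (hloss : M.loss β π ≤ ENNReal.ofReal ℓ) {l : ℝ} (hl : 0 < l) :
    ∫⁻ s, M.value (M.rcsl β f) M.horizon s ∂M.init ≤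
      ∫⁻ s, M.value (π.test f hf) M.horizon s ∂M.init +
        ENNReal.ofReal (2 * (Cf / α) * (M.horizon : ℝ) ^ 2 * (l * ℓ + l⁻¹)) := by
  have := M.isMarkovKernel_rcsl β hf
  have hpos := M.horizon_pos
  set π' := π.test f hf
  have hm := M.measurable_remainingActionValue π'
  set b : S → ℝ≥0∞ := fun s => ∫⁻ a, M.remainingActionValue π' s a ∂M.rcsl β f s -
    ∫⁻ a, M.remainingActionValue π' s a ∂π' s with hb
  have hbm : Measurable b := (Measurable.lintegral_kernel_prod_right' hm).sub
    (Measurable.lintegral_kernel_prod_right' hm)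
  have hQ : ∀ q : S × A, M.remainingActionValue π' q.1 q.2 ≤ 2 * (M.horizon : ℝ≥0∞) := fun q => by
    refine (M.actionValue_le π' _ _ _).trans ?_
    -- The bound must hold at every state, even one of time `0`, where it reads `H + 1`; hence `2 H`
    -- instead of `H`.
    have : M.horizon - M.time q.1 + 1 ≤ 2 * M.horizon := by omega
    exact_mod_cast this
  have hgap := M.mul_lintegral_occ_sub_le β hf hα hcov π hm
    (ENNReal.mul_ne_top ENNReal.ofNat_ne_top (ENNReal.natCast_ne_top _)) hQ hl
  have hα0 : ENNReal.ofReal α ≠ 0 := by simpa using hα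
  have hgap' : ∫⁻ s, b s ∂M.occ β ≤
      (2 * (M.horizon : ℝ≥0∞) * (ENNReal.ofReal l * ENNReal.ofReal ℓ + ENNReal.ofReal l⁻¹)) /
        ENNReal.ofReal α := by
    rw [ENNReal.le_div_iff_mul_le (Or.inl hα0) (Or.inl ENNReal.ofReal_ne_top), mul_comm]
    refine hgap.trans ?_
    gcongr
  calc _ ≤ ∫⁻ s, M.value π' M.horizon s + M.visits (M.rcsl β f) b M.horizon s ∂M.init := by
        refine lintegral_mono_ae ?_
        filter_upwards [M.init_time] with s hs
        exact M.value_le_value_add_visits _ π' _ s (Or.inr (by omega))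
    _ = ∫⁻ s, M.value π' M.horizon s ∂M.init +
        M.horizon * ∫⁻ s, b s ∂M.occ (M.rcsl β f) := by
        rw [lintegral_add_left (M.measurable_value π' _), M.lintegral_occ _ hbm]
    _ ≤ ∫⁻ s, M.value π' M.horizon s ∂M.init +
        M.horizon * (ENNReal.ofReal Cf * ((2 * (M.horizon : ℝ≥0∞) *
          (ENNReal.ofReal l * ENNReal.ofReal ℓ + ENNReal.ofReal l⁻¹)) / ENNReal.ofReal α)) := by
        gcongr
        refine (lintegral_mono' hocc le_rfl).trans ?_
        rw [lintegral_smul_measure, smul_eq_mul]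
        gcongr
    _ = _ := by
        congr 1
        rw [← ENNReal.ofReal_mul hl.le, ← ENNReal.ofReal_add (by positivity) (by positivity),
          ← ENNReal.ofReal_natCast, ← ENNReal.ofReal_ofNat 2, ← ENNReal.ofReal_mul (by positivity),
          ← ENNReal.ofReal_mul (by positivity), ← ENNReal.ofReal_div_of_pos hα,
          ← ENNReal.ofReal_mul hCf, ← ENNReal.ofReal_mul (by positivity)]
        congr 1
        ring

/-- The learned policy nearly matches the deterministic optimal policy when its loss is small. -/
theorem J_sub_J_test_le (M : MDP S A) (β : Kernel S A) [IsMarkovKernel β]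
    {σ : S → A} (hσ : Measurable σ) {T : S → A → S} {ρ : S → A → ℝ} {ε : ℝ}
    (hdet : M.NearlyDeterministic T ρ ε) {f : S → ℝ}
    (hf : Measurable f) (hfσ : ∀ᵐ s ∂M.init, f s = M.detReturn T ρ σ s) (hcons : M.Consistent f)
    {α : ℝ} (hα : 0 < α) (hcov : M.Covers β f α) {Cf : ℝ} (hCf : 0 ≤ Cf)
    (hocc : M.occ (M.rcsl β f) ≤ ENNReal.ofReal Cf • M.occ β) (π : CondPolicy S A ν) {ℓ : ℝ}
    (hℓ : 0 ≤ ℓ) (hloss : M.loss β π ≤ ENNReal.ofReal ℓ) :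
    M.J (Kernel.deterministic σ hσ) - M.J (π.test f hf) ≤
      4 * (Cf / α) * (M.horizon : ℝ) ^ 2 * √ℓ + 2 * (ε / α * (M.horizon : ℝ) ^ 2) := by
  have := M.isMarkovKernel_rcsl β hf
  have := M.isProbabilityMeasure_occ β
  have hH : (1 : ℝ) ≤ M.horizon := by exact_mod_cast M.horizon_pos
  obtain ⟨s, hs⟩ := hcov.exists
  have hα1 : α ≤ 1 := hs.trans measureReal_le_one
  have hε0 : 0 ≤ ε := measureReal_nonneg.trans (hdet s (Classical.arbitrary A))
  have hεα : ε ≤ ε / α := le_div_self hε0 hα hα1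
  have hK : 0 ≤ Cf / α := by positivity
  -- For `ε ≥ 1` the claim is trivial, since returns differ by at most `H`.
  rcases le_or_gt 1 ε with hε | hε
  · have h1 := M.J_le_horizon (Kernel.deterministic σ hσ)
    have h2 := M.J_nonneg (π.test f hf)
    have h3 : (M.horizon : ℝ) ≤ ε / α * (M.horizon : ℝ) ^ 2 := by
      have : 1 * (M.horizon : ℝ) ^ 2 ≤ ε / α * (M.horizon : ℝ) ^ 2 := by
        gcongr; exact hε.trans hεα
      nlinarith
    have h4 : 0 ≤ 4 * (Cf / α) * (M.horizon : ℝ) ^ 2 * √ℓ := by positivity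
    have h5 : 0 ≤ ε / α * (M.horizon : ℝ) ^ 2 := by positivity
    linarith
  have hac : M.occ (M.rcsl β f) ≪ M.occ β :=
    (Measure.absolutelyContinuous_of_le hocc).trans Measure.smul_absolutelyContinuous
  have h1 := M.lintegral_value_le_rcsl β hσ hdet hε0 hε hf hfσ hcons hα hcov hac
  have hl : ∀ l : ℝ, 0 < l → M.J (Kernel.deterministic σ hσ) - M.J (π.test f hf) ≤
      2 * (Cf / α) * (M.horizon : ℝ) ^ 2 * (l * ℓ + l⁻¹) +
        (M.horizon : ℝ) ^ 2 * (ε / α + ε) := by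
    intro l hl
    have h2 := M.lintegral_value_rcsl_le β hf hα hcov hCf hocc π hℓ hloss hl
    refine M.J_sub_le _ _ (by positivity) ?_
    rw [ENNReal.ofReal_add (by positivity) (by positivity), ← add_assoc]
    exact h1.trans (add_le_add h2 le_rfl)
  have hεH : (M.horizon : ℝ) ^ 2 * (ε / α + ε) ≤ 2 * (ε / α * (M.horizon : ℝ) ^ 2) := by
    nlinarith [mul_le_mul_of_nonneg_left hεα (sq_nonneg (M.horizon : ℝ))]
  set κ := 2 * (Cf / α) * (M.horizon : ℝ) ^ 2 with hκ
  have hκ0 : 0 ≤ κ := by positivity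
  refine le_of_forall_pos_le_add fun η hη => ?_
  -- The optimal `l = 1 / √ℓ` is undefined at `ℓ = 0`; a shift by `θ` avoids this at a cost of at
  -- most `η`.
  set θ := η / (κ + 1) with hθ
  have hθ0 : 0 < θ := by positivity
  have hκθ : κ * θ ≤ η := by
    rw [hθ, mul_div_assoc', div_le_iff₀ (by positivity)]
    nlinarith
  have hr := Real.sqrt_nonneg ℓ
  have hbd : (√ℓ + θ)⁻¹ * ℓ ≤ √ℓ := by
    rw [inv_mul_le_iff₀ (by positivity)]
    nlinarith [Real.mul_self_sqrt hℓ]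
  have h2 := hl (√ℓ + θ)⁻¹ (by positivity)
  rw [inv_inv] at h2
  have h3 : κ * ((√ℓ + θ)⁻¹ * ℓ + (√ℓ + θ)) ≤ κ * (√ℓ + (√ℓ + θ)) := by gcongr
  have h4 : 4 * (Cf / α) * (M.horizon : ℝ) ^ 2 * √ℓ = 2 * κ * √ℓ := by rw [hκ]; ring
  rw [h4]
  linarith

end MDP

end

theorem corollary4 :
    ∃ K : ℝ, 0 < K ∧
      ∀ (S : Type u) (A : Type v) [MeasurableSpace S] [StandardBorelSpace S]
        [MeasurableSpace A] [StandardBorelSpace A] [Nonempty A]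
        (M : MDP S A) (β : Kernel S A) [IsMarkovKernel β]
        -- an optimal policy, chosen deterministic
        (σ : S → A) (hσ : Measurable σ) (_ : M.IsOptimal (Kernel.deterministic σ hσ))
        -- near determinism
        (T : S → A → S) (_ : Measurable (Function.uncurry T))
        (ρ : S → A → ℝ) (_ : Measurable (Function.uncurry ρ))
        (ε : ℝ) (_ : M.NearlyDeterministic T ρ ε)
        -- the conditioning function
        (f : S → ℝ) (hf : Measurable f) (_ : ∀ᵐ s ∂M.init, f s = M.detReturn T ρ σ s)
        (_ : M.Consistent f)
        (α : ℝ) (_ : 0 < α) (_ : M.Covers β f α)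
        (Cf : ℝ) (_ : M.occ (M.rcsl β f) ≤ ENNReal.ofReal Cf • M.occ β)
        -- the policy class
        (ν : Measure A) [SigmaFinite ν] (C : Finset (CondPolicy S A ν))
        (c : ℝ) (_ : ∀ π ∈ C, π.LogBounded c)
        (εa : ℝ) (_ : 0 ≤ εa) (_ : ∃ π ∈ C, M.loss β π ≤ ENNReal.ofReal εa)
        -- the sample size and the failure probability
        (N : ℕ) (_ : 0 < N) (δ : ℝ) (_ : 0 < δ) (_ : δ < 1),
        1 - δ ≤ (Measure.pi fun _ : Fin N => M.traj β).real
          {D | ∀ π, IsERM C D π →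
            M.J (Kernel.deterministic σ hσ) - M.J (π.test f hf) ≤
              K * (Cf / α * (M.horizon : ℝ) ^ 2 *
                  (√c * (Real.log (C.card / δ) / N) ^ (1 / 4 : ℝ) + √εa)
                + ε / α * (M.horizon : ℝ) ^ 2)} := by
  -- The factor `4` of `J_sub_J_test_le` times the factor `2` from splitting the square root of the
  -- loss.
  refine ⟨8, by norm_num, ?_⟩
  intro S A _ _ _ _ _ M β _ σ hσ _ T _ ρ _ ε hdet f hf hfσ hcons α hα hcov Cf hocc ν _ C c hC
    εa hεa hloss N hN δ hδ hδ1
  obtain ⟨π₀, h₀, hloss₀⟩ := hloss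
  have := M.isMarkovKernel_rcsl β hf
  have := M.isProbabilityMeasure_occ β
  have := M.isProbabilityMeasure_occ (M.rcsl β f)
  obtain ⟨s₀⟩ : Nonempty S := M.init.nonempty_of_neZero
  set q₀ : (S × ℝ) × A := ((s₀, 0), Classical.arbitrary A)
  have hc0 : 0 ≤ c := (abs_nonneg _).trans ((hC π₀ h₀).abs_logDens_sub_le q₀ q₀)
  have hCf0 : 0 ≤ Cf := by
    have h1 := hocc Set.univ
    by_contra! hneg
    rw [ENNReal.ofReal_of_nonpos hneg.le] at h1
    simp at h1
  have hN' : (0 : ℝ) < N := by exact_mod_cast hN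
  have hcard : (1 : ℝ) ≤ C.card := by exact_mod_cast Finset.card_pos.2 ⟨π₀, h₀⟩
  have hlog : 0 ≤ Real.log (C.card / δ) :=
    Real.log_nonneg ((one_le_div hδ).2 (hδ1.le.trans hcard))
  set x := Real.log (C.card / δ) / N with hx
  have hx0 : 0 ≤ x := by positivity
  have hr2 : (c * (4 * √x)) ^ 2 = 16 * c ^ 2 * x := by
    rw [mul_pow, mul_pow, Real.sq_sqrt hx0]; ring
  -- The constant `4` satisfies `8 ≤ 4²`, as the concentration bound requires, and has a rational
  -- square root.
  have hgood := M.one_sub_le_measureReal_isERM β hc0 hC h₀ q₀ hN hδ (r := c * (4 * √x))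
    (by positivity) (by
      have h1 : Real.log (C.card / δ) = N * x := by rw [hx]; field_simp
      rw [hr2, h1]
      have : 0 ≤ c ^ 2 * (N * x) := by positivity
      nlinarith)
  refine hgood.trans (measureReal_mono fun D hD π hπ => ?_)
  have hex := hD π hπ
  have hπC := hC π hπ.1
  -- Any finite bound serves: it is added to both sides of the loss comparison and cancelled.
  have hB : ∀ q, |π.logDens q - π₀.logDens q| ≤ |π.logDens q₀ - π₀.logDens q₀| + 2 * c :=
    fun q => by
      have h1 := hπC.abs_logDens_sub_le q q₀
      have h2 := (hC π₀ h₀).abs_logDens_sub_le q₀ q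
      have h3 : π.logDens q - π₀.logDens q = (π.logDens q - π.logDens q₀) +
        (π.logDens q₀ - π₀.logDens q₀) + (π₀.logDens q₀ - π₀.logDens q) := by ring
      rw [h3]
      have h4 := abs_add_three (π.logDens q - π.logDens q₀) (π.logDens q₀ - π₀.logDens q₀)
        (π₀.logDens q₀ - π₀.logDens q)
      linarith
  set B := |π.logDens q₀ - π₀.logDens q₀| + 2 * c
  have hB0 : 0 ≤ B := by positivity
  have hlossπ : M.loss β π ≤ ENNReal.ofReal (εa + c * (4 * √x)) := by
    refine (ENNReal.add_le_add_iff_right (ENNReal.ofReal_ne_top (r := B))).1 ?_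
    refine (M.loss_add_le β hπC.1 (hC π₀ h₀).1 hB).trans ?_
    rw [← ENNReal.ofReal_add (by positivity) hB0]
    have h1 : εa + c * (4 * √x) + B = εa + (B + c * (4 * √x)) := by ring
    rw [h1, ENNReal.ofReal_add hεa (by positivity)]
    gcongr
  have hsqrt : √(εa + c * (4 * √x)) ≤ 2 * (√c * x ^ (1 / 4 : ℝ) + √εa) := by
    have h1 : √(√x) = x ^ (1 / 4 : ℝ) := by
      rw [Real.sqrt_eq_rpow, Real.sqrt_eq_rpow, ← Real.rpow_mul hx0]; norm_num
    have h2 : √(4 * √x) = 2 * x ^ (1 / 4 : ℝ) := by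
      rw [Real.sqrt_mul (by norm_num), h1, show (4 : ℝ) = 2 ^ 2 by norm_num,
        Real.sqrt_sq (by norm_num)]
    have h3 : √(εa + c * (4 * √x)) ≤ √εa + √(c * (4 * √x)) := by
      have hy : 0 ≤ c * (4 * √x) := by positivity
      refine Real.sqrt_le_iff.2 ⟨by positivity, ?_⟩
      nlinarith [Real.sq_sqrt hεa, Real.sq_sqrt hy, Real.sqrt_nonneg εa,
        mul_nonneg (Real.sqrt_nonneg εa) (Real.sqrt_nonneg (c * (4 * √x)))]
    rw [Real.sqrt_mul hc0, h2] at h3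
    have h4 := Real.sqrt_nonneg εa
    linarith
  have hε0 : 0 ≤ ε := measureReal_nonneg.trans (hdet s₀ (Classical.arbitrary A))
  refine (M.J_sub_J_test_le β hσ hdet hf hfσ hcons hα hcov hCf0 hocc π
    (by positivity) hlossπ).trans ?_
  have hK : 0 ≤ Cf / α * (M.horizon : ℝ) ^ 2 := by positivity
  have hE : 0 ≤ ε / α * (M.horizon : ℝ) ^ 2 := by positivity
  have h5 := mul_le_mul_of_nonneg_left hsqrt hK
  linarith
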